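/- Let $G=\langle S,s_0,E,S_1,S_P,\delta\rangle$ be a finite Markov decision process: $S$ is finite, $(S_1,S_P)$ is a partition of $S$ into player-1 states and probabilistic states, $\delta:S_P\to\mathcal D(S)$ satisfies $(s,t)\in E$ iff $\delta(s)(t)>0$ for $s\in S_P$, and every state has an outgoing edge. Strategies $\pi$ of player 1 may depend on the history and may be randomized, and may only use available edges; $\mathbb E_s^\pi$ is the expectation over plays $\omega=\omega_0\omega_1\ldots$ that start in $s$ when player 1 follows $\pi$. Let $p:S\to\mathbb N$ be a priority function and $r:S\to\mathbb R$ a reward function. Put $$\mathrm{Mean}[r](\omega)=\liminf_{n\to\infty}\frac1n\sum_{i=0}^{n-1}r(\omega_i),$$ and let $\mathrm{MP}[p,r](\omega)=\mathrm{Mean}[r](\omega)$ if the least priority that occurs infinitely often in $\omega$ is even, and $\mathrm{MP}[p,r](\omega)=\bot$ otherwise. Here $\bot$ is smaller than every real number, and the expectation of an objective is $\bot$ if the objective takes the value $\bot$ with positive probability. For an objective $f$ let $\mathrm{Val}_G(f)(s)=\sup_\pi\mathbb E_s^\pi[f]$; a strategy $\pi$ is optimal for $f$ from $s$ if $\mathbb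 E_s^\pi[f]=\mathrm{Val}_G(f)(s)$. Suppose that $S$ is an end component of $G$ (that is, the graph $(S,E)$ is strongly connected) and that the minimum priority $\min_{s\in S}p(s)$ is even. Then: 1. $\mathrm{Val}_G(\mathrm{MP}[p,r])(s)=\mathrm{Val}_G(\mathrm{Mean}[r])(s)$ for every $s\in S$. 2. There is a pure memoryless strategy $\pi_S$ that from every state reaches a state of minimum priority with probability $1$. 3. There is a pure memoryless strategy $\pi_m$ that is optimal for $\mathrm{Mean}[r]$ from every state. 4. Let $\pi_S$ and $\pi_m$ be any pure memoryless strategies as in 2 and 3, and let $\ell(i,k)$ be any positive integers with $\inf_k\ell(i,k)\to\infty$ as $i\to\infty$. Consider the counter-based strategy that is played in rounds $i=1,2,\ldots$, where round $i$ first plays $\pi_S$ until a state of minimum priority is reached (immediately, if the current state has minimum priority), say after $k\ge 0$ steps, then plays $\pi_m$ for $\ell(i,k)$ steps, and is followed by round $i+1$. This strategy is optimal for $\mathrm{MP}[p,r]$ from every state $s$; by 1, it attains the value $\mathrm{Val}_G(\mathrm{Mean}[r])(s)$. -/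

import Mathlib

open MeasureTheory ProbabilityTheory Filter Finset

noncomputable section

/-- A Markov decision process `⟨S, s₀, E, S₁, S_P, δ⟩`. The player-1 states are `player`, and all
other states are probabilistic. -/
structure MDP (S : Type*) where
  init : S
  edge : S → S → Prop
  player : Set S
  trans : {s : S // s ∉ player} → PMF S
  edge_iff : ∀ (s : {s : S // s ∉ player}) (t : S), edge s t ↔ trans s t ≠ 0
  exists_edge : ∀ s : S, ∃ t : S, edge s t

namespace MDP

variable {S : Type*}

/-- A set of states is an end component if it is closed under probabilistic moves and the sub-game
restricted to it is strongly connected: between any two of its states there is a nonempty path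
that stays inside (for one and the same state, a cycle). -/
def IsEndComponent (G : MDP S) (U : Set S) : Prop :=
  U.Nonempty ∧ (∀ s ∈ U, s ∉ G.player → ∀ t, G.edge s t → t ∈ U) ∧
    ∀ s ∈ U, ∀ t ∈ U, Relation.TransGen (fun a b => a ∈ U ∧ b ∈ U ∧ G.edge a b) s t

/-- A (history-dependent, randomized) strategy of player 1. `move v s` is the distribution that is
played after the history `v s`, where `v` is any finite sequence of states (oldest state first)
and `s` is a player-1 state. Only available moves may be prescribed. -/
structure Strategy (G : MDP S) where
  move : List S → G.player → PMF S
  available : ∀ (v : List S) (s : G.player) (t : S), move v s t ≠ 0 → G.edge s t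

/-- A pure memoryless strategy, represented as a function from player-1 states to states. -/
structure PureMemoryless (G : MDP S) where
  move : G.player → S
  available : ∀ s : G.player, G.edge s (move s)

/-- A pure memoryless strategy, as a strategy. -/
def PureMemoryless.toStrategy {G : MDP S} (σ : G.PureMemoryless) : G.Strategy where
  move _ s := PMF.pure (σ.move s)
  available v s t h := by
    have : t = σ.move s := by
      by_contra hne
      exact h (by simp [PMF.pure_apply, hne])
    exact this ▸ σ.available s

section Law

variable [Fintype S] [MeasurableSpace S] [MeasurableSingletonClass S]

open Classical in
/-- The distribution of the next state after the history `v s`. -/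
def nextState (G : MDP S) (π : G.Strategy) (v : List S) (s : S) : PMF S :=
  if h : s ∈ G.player then π.move v ⟨s, h⟩ else G.trans ⟨s, h⟩

/-- The distribution of the state at time `n + 1`, given the states `x 0, …, x n`. -/
def stepKernel (G : MDP S) (π : G.Strategy) (n : ℕ) :
    Kernel (Π _ : Finset.Iic n, S) S :=
  Kernel.ofFunOfCountable fun x =>
    (G.nextState π (List.ofFn fun i : Fin n => x ⟨i, Finset.mem_Iic.2 i.2.le⟩)
      (x ⟨n, Finset.mem_Iic.2 le_rfl⟩)).toMeasure

instance (G : MDP S) (π : G.Strategy) (n : ℕ) : IsMarkovKernel (G.stepKernel π n) :=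
  ⟨fun _ => by
    simp only [stepKernel, Kernel.ofFunOfCountable, Kernel.coe_mk]
    infer_instance⟩

/-- The law `μ_s^π` of the play that starts in `s` when player 1 follows `π`. -/
def law (G : MDP S) (π : G.Strategy) (s : S) : Measure (ℕ → S) :=
  Kernel.traj (X := fun _ => S) (G.stepKernel π) 0 fun _ => s

open Classical in
/-- The expectation `𝔼_s^π[f]` of an objective `f` with values in `ℝ ∪ {⊥}`. It is `⊥` as soon as
`f` takes the value `⊥` with positive probability. -/
def expectation (G : MDP S) (π : G.Strategy) (s : S) (f : (ℕ → S) → WithBot ℝ) : EReal :=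
  if ∀ᵐ ω ∂(G.law π s), f ω ≠ ⊥ then
    ((∫ ω, (f ω).unbotD 0 ∂(G.law π s) : ℝ) : EReal)
  else ⊥

/-- The value of the objective `f` at `s`: the supremum over all strategies of the expectation. -/
def value (G : MDP S) (f : (ℕ → S) → WithBot ℝ) (s : S) : EReal :=
  ⨆ π : G.Strategy, G.expectation π s f

/-- The strategy `π` is optimal from `s` for the objective `f`. -/
def IsOptimalFrom (G : MDP S) (f : (ℕ → S) → WithBot ℝ) (π : G.Strategy) (s : S) : Prop :=
  G.value f s = G.expectation π s f

end Law

/-- The set of states that occur infinitely often in `ω`. -/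
def infSet (ω : ℕ → S) : Set S := {s | ∃ᶠ n in atTop, ω n = s}

/-- The parity objective: the least priority that is seen infinitely often is even. -/
def Parity (p : S → ℕ) (ω : ℕ → S) : Prop := Even (sInf (p '' infSet ω))

/-- The mean-payoff of a play: the lower limit of the averages of the rewards. -/
def meanPayoff (r : S → ℝ) (ω : ℕ → S) : WithBot ℝ :=
  ((liminf (fun n : ℕ => (∑ i ∈ Finset.range n, r (ω i)) / (n : ℝ)) atTop : ℝ) : WithBot ℝ)

open Classical in
/-- The mean-payoff parity objective. -/
def meanPayoffParity (p : S → ℕ) (r : S → ℝ) (ω : ℕ → S) : WithBot ℝ :=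
  if Parity p ω then meanPayoff r ω else ⊥

/-- The minimum priority of the state space. -/
def minPriority (p : S → ℕ) : ℕ := sInf (Set.range p)

/-! ### The counter-based strategy

It is played in rounds `i = 1, 2, …`. Round `i` first plays `σS` until a state of minimum priority
is reached, say after `k ≥ 0` steps, and then plays `σm` for `ℓ i k` steps. -/

/-- The memory of the counter-based strategy: the number `i` of the round, the stage, and a
counter. -/
inductive CounterMemory where
  /-- stage 1 of round `i`, of which `k` steps have been played -/
  | reach (i k : ℕ)
  /-- stage 2 of round `i`, of which `m` steps remain to be played -/
  | optimize (i m : ℕ)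

open CounterMemory

/-- Stage 1 of round `i` with `k` steps played, at the state `s`: it is over, and stage 2 begins,
if `s` has minimum priority. -/
def enterRound (p : S → ℕ) (ℓ : ℕ → ℕ → ℕ) (i k : ℕ) (s : S) : CounterMemory :=
  if p s = minPriority p then optimize i (ℓ i k) else reach i k

/-- The stage that determines the move at the state `s`, given the memory on arrival in `s`. -/
def currentStage (p : S → ℕ) (ℓ : ℕ → ℕ → ℕ) : CounterMemory → S → CounterMemory
  | reach i k, s => enterRound p ℓ i k s
  | optimize i 0, s => enterRound p ℓ (i + 1) 0 s
  | optimize i (m + 1), _ => optimize i (m + 1)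

/-- Count one step of the current stage. -/
def countStep : CounterMemory → CounterMemory
  | reach i k => reach i (k + 1)
  | optimize i m => optimize i (m - 1)

/-- The memory after the history `v`; the play starts in stage 1 of round 1. -/
def memoryAfter (p : S → ℕ) (ℓ : ℕ → ℕ → ℕ) (v : List S) : CounterMemory :=
  v.foldl (fun q s => countStep (currentStage p ℓ q s)) (reach 1 0)

/-- The counter-based strategy that alternates between `σS` and `σm` with stage lengths `ℓ`. -/
def counterStrategy {G : MDP S} (p : S → ℕ) (σS σm : G.PureMemoryless) (ℓ : ℕ → ℕ → ℕ) :
    G.Strategy where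
  move v s :=
    match currentStage p ℓ (memoryAfter p ℓ v) s with
    | reach _ _ => σS.toStrategy.move v s
    | optimize _ _ => σm.toStrategy.move v s
  available v s t h := by
    split at h
    · exact σS.toStrategy.available v s t h
    · exact σm.toStrategy.available v s t h

/-- The stage lengths are positive, and grow beyond all bounds with the number `i` of the round,
uniformly in the number `k` of steps of stage 1. -/
def GrowingLengths (ℓ : ℕ → ℕ → ℕ) : Prop :=
  (∀ i k, 0 < ℓ i k) ∧ ∀ N : ℕ, ∀ᶠ i in atTop, ∀ k, N ≤ ℓ i k

end MDP

end

/-! Everything rests on the average reward optimality equation `h + v = r + opt h` with a constant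
`v`, which strong connectivity provides (`exists_optimality_equation`, by vanishing discount).
Telescoping it shows that under any strategy the expected `n`-step average is at most `v + O(1/n)`,
while a greedy pure memoryless strategy has averages that tend to `v` almost surely. So `v` is the
mean-payoff value at every state and an upper bound for the parity version. If the reward is the
indicator of a nonempty target set, then `v > 0`, and the greedy strategy must visit the target;
this is part 2.

In part 4, `σm` is an arbitrary optimal strategy and need not be greedy for `h`. But its optimality
makes the Cesàro means of `r - v` under its transition operator `P` vanish, so that `r - v = (1 - P)
g` for some `g` (`exists_poisson`). Stage 2 of the counter-based strategy satisfies this Poisson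
equation exactly, and stage 1 violates it by a bounded amount; hence the averages tend to `v` once
stage 1 takes a vanishing fraction of the time.

For that fraction, take a potential `K` that drops by at least 1 in expectation at each step of
stage 1 (`exists_reach_potential`). Up to a martingale, the total time in stage 1 is then at most a
constant times the number of rounds (`sum_reachInd_le`), which is `o(n)` because the stages 2 grow.
The vanishing fraction also forces infinitely many visits to the minimum priority, since otherwise
the play would end up in stage 1 forever. All random fluctuations are handled by one strong law,
`ae_tendsto_mgSum_div`. -/

noncomputable section

/-! ### Finite histories and a strong law for martingale transforms. -/

namespace MDP

variable {S : Type*}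

/-- The states visited by the play `ω` before time `n`. -/
def hist (ω : ℕ → S) (n : ℕ) : List S := List.ofFn fun i : Fin n => ω i

/-- A quantity that is determined by the play up to time `n`. -/
def DependsUpTo {α : Type*} (n : ℕ) (F : (ℕ → S) → α) : Prop :=
  ∀ ω ω', (∀ i ≤ n, ω i = ω' i) → F ω = F ω'

theorem hist_congr {n : ℕ} {ω ω' : ℕ → S} (h : ∀ i < n, ω i = ω' i) : hist ω n = hist ω' n := by
  unfold hist
  congr 1
  funext i
  exact h i i.2

theorem hist_succ (ω : ℕ → S) (n : ℕ) : hist ω (n + 1) = hist ω n ++ [ω n] := by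
  unfold hist
  rw [List.ofFn_succ_last]
  rfl

/-- An arbitrary continuation of a finite history. -/
def extend (n : ℕ) (x : Π _ : Finset.Iic n, S) : ℕ → S :=
  fun i => if h : i ≤ n then x ⟨i, Finset.mem_Iic.2 h⟩ else x ⟨n, Finset.mem_Iic.2 le_rfl⟩

/-- Factoring through the finite type of histories is what makes such quantities measurable, bounded
and integrable without further hypotheses. -/
theorem DependsUpTo.eq_extend {α : Type*} {n : ℕ} {F : (ℕ → S) → α} (hF : DependsUpTo n F)
    (ω : ℕ → S) : F ω = F (extend n (Preorder.frestrictLe n ω)) := by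
  apply hF
  intro i hi
  simp [extend, hi]

theorem DependsUpTo.mono {α : Type*} {n m : ℕ} (hnm : n ≤ m) {F : (ℕ → S) → α}
    (hF : DependsUpTo n F) : DependsUpTo m F :=
  fun ω ω' h => hF ω ω' fun i hi => h i (hi.trans hnm)

/-- A sequence with bounded increments that is `o(n)` along the squares is `o(n)`. -/
theorem tendsto_div_of_sq {u : ℕ → ℝ} {C : ℝ} (hu : ∀ n, |u (n + 1) - u n| ≤ C)
    (hsq : Tendsto (fun k : ℕ => u (k ^ 2) / (k : ℝ) ^ 2) atTop (nhds 0)) :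
    Tendsto (fun n : ℕ => u n / n) atTop (nhds 0) := by
  have hC : 0 ≤ C := (abs_nonneg _).trans (hu 0)
  have hgap : ∀ m d, |u (m + d) - u m| ≤ C * d := by
    intro m d
    induction d with
    | zero => simp
    | succ d ih =>
      have := abs_sub_le (u (m + (d + 1))) (u (m + d)) (u m)
      have := hu (m + d)
      push_cast
      rw [← add_assoc] at *
      linarith
  have hsqrt : Tendsto Nat.sqrt atTop atTop :=
    tendsto_atTop.2 fun b => (eventually_ge_atTop (b ^ 2)).mono fun n hn => by
      rw [Nat.le_sqrt']; exact hn
  have hinv : Tendsto (fun k : ℕ => 2 * C * ((k : ℝ)⁻¹)) atTop (nhds 0) := by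
    simpa using tendsto_inv_atTop_nhds_zero_nat.const_mul (2 * C)
  -- With `k = n.sqrt` one has `k ^ 2 ≤ n ≤ k ^ 2 + 2 * k`, so the increments after time `k ^ 2`
  -- contribute at most `2 * C * k`, which is `2 * C / k` after division by `k ^ 2`.
  have hb : Tendsto (fun n : ℕ => |u (n.sqrt ^ 2) / (n.sqrt : ℝ) ^ 2| +
      2 * C * ((n.sqrt : ℝ)⁻¹)) atTop (nhds 0) := by
    have := (hsq.abs.add hinv).comp hsqrt
    simpa [Function.comp_def] using this
  refine squeeze_zero_norm' ?_ hb
  filter_upwards [eventually_ge_atTop 1] with n hn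
  generalize hk : n.sqrt = k
  have hk1 : 1 ≤ k := by rw [← hk, Nat.le_sqrt']; simpa using hn
  have hle : k ^ 2 ≤ n := hk ▸ Nat.sqrt_le' n
  have hlt : n ≤ k ^ 2 + 2 * k := by
    have := Nat.sqrt_le_add n
    rw [hk] at this
    nlinarith
  clear hk
  obtain ⟨d, rfl⟩ := Nat.exists_eq_add_of_le hle
  have hd : d ≤ 2 * k := by omega
  have hd' : (d : ℝ) ≤ 2 * k := by exact_mod_cast hd
  have hkR : (1 : ℝ) ≤ k := by exact_mod_cast hk1
  have hn0 : (0 : ℝ) < (k : ℝ) ^ 2 := by positivity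
  have h1 : |u (k ^ 2 + d)| ≤ |u (k ^ 2)| + 2 * C * k := by
    have h := hgap (k ^ 2) d
    have h2 := abs_sub_abs_le_abs_sub (u (k ^ 2 + d)) (u (k ^ 2))
    have : C * d ≤ C * (2 * k) := mul_le_mul_of_nonneg_left hd' hC
    linarith
  rw [Real.norm_eq_abs, abs_div, abs_div, Nat.abs_cast, abs_of_pos hn0]
  calc |u (k ^ 2 + d)| / ((k ^ 2 + d : ℕ) : ℝ) ≤ |u (k ^ 2 + d)| / (k : ℝ) ^ 2 := by
        apply div_le_div_of_nonneg_left (abs_nonneg _) hn0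
        push_cast; linarith [Nat.cast_nonneg (α := ℝ) d]
    _ ≤ (|u (k ^ 2)| + 2 * C * k) / (k : ℝ) ^ 2 := by gcongr
    _ = _ := by field_simp

section Finite

variable [Fintype S]

/-- The expectation of `f` at the next state after the history `v s`. -/
def nextExp (G : MDP S) (π : G.Strategy) (v : List S) (s : S) (f : S → ℝ) : ℝ :=
  ∑ t, (G.nextState π v s t).toReal * f t

theorem sum_toReal_pmf (q : PMF S) : ∑ t, (q t).toReal = 1 := by
  rw [← ENNReal.toReal_sum fun a _ => PMF.apply_ne_top q a]
  rw [← tsum_fintype (L := .unconditional S), q.tsum_coe, ENNReal.toReal_one]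

theorem nextExp_const (G : MDP S) (π : G.Strategy) (v : List S) (s : S) (a : ℝ) :
    G.nextExp π v s (fun _ => a) = a := by
  simp [nextExp, ← Finset.sum_mul, sum_toReal_pmf]

theorem nextExp_sub (G : MDP S) (π : G.Strategy) (v : List S) (s : S) (f g : S → ℝ) :
    G.nextExp π v s (fun t => f t - g t) = G.nextExp π v s f - G.nextExp π v s g := by
  simp [nextExp, mul_sub]

theorem nextExp_const_mul (G : MDP S) (π : G.Strategy) (v : List S) (s : S) (a : ℝ) (f : S → ℝ) :
    G.nextExp π v s (fun t => a * f t) = a * G.nextExp π v s f := by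
  simp only [nextExp, Finset.mul_sum]
  exact Finset.sum_congr rfl fun _ _ => by ring

theorem nextExp_mono (G : MDP S) (π : G.Strategy) (v : List S) (s : S) {f g : S → ℝ}
    (h : ∀ t, f t ≤ g t) : G.nextExp π v s f ≤ G.nextExp π v s g :=
  Finset.sum_le_sum fun t _ => mul_le_mul_of_nonneg_left (h t) ENNReal.toReal_nonneg

theorem abs_nextExp_le (G : MDP S) (π : G.Strategy) (v : List S) (s : S) {f : S → ℝ} {C : ℝ}
    (h : ∀ t, |f t| ≤ C) : |G.nextExp π v s f| ≤ C := by
  rw [abs_le]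
  constructor
  · have := G.nextExp_mono π v s (f := fun _ => -C) (g := f) fun t => (abs_le.1 (h t)).1
    rwa [nextExp_const] at this
  · have := G.nextExp_mono π v s (g := fun _ => C) (f := f) fun t => (abs_le.1 (h t)).2
    rwa [nextExp_const] at this

theorem DependsUpTo.exists_bound {n : ℕ} {F : (ℕ → S) → ℝ} (hF : DependsUpTo n F) :
    ∃ C, ∀ ω, |F ω| ≤ C := by
  refine ⟨∑ x : Π _ : Finset.Iic n, S, |F (extend n x)|, fun ω => ?_⟩
  rw [hF.eq_extend ω]
  exact Finset.single_le_sum (f := fun x : Π _ : Finset.Iic n, S => |F (extend n x)|)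
    (fun _ _ => abs_nonneg _) (Finset.mem_univ _)

/-- The increment of a martingale transform: `c` times the difference between the value of `g` at
the next state and its conditional expectation. -/
def mgInc (G : MDP S) (π : G.Strategy) (c : ℕ → (ℕ → S) → ℝ) (g : S → ℝ) (n : ℕ) (ω : ℕ → S) : ℝ :=
  c n ω * (g (ω (n + 1)) - G.nextExp π (hist ω n) (ω n) g)

theorem dependsUpTo_nextExp (G : MDP S) (π : G.Strategy) (g : S → ℝ) (n : ℕ) :
    DependsUpTo n fun ω => G.nextExp π (hist ω n) (ω n) g := by
  intro ω ω' h
  simp only [hist_congr fun i hi => h i hi.le, h n le_rfl]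

theorem dependsUpTo_mgInc (G : MDP S) (π : G.Strategy) {c : ℕ → (ℕ → S) → ℝ} (g : S → ℝ)
    (hc : ∀ n, DependsUpTo n (c n)) (n : ℕ) : DependsUpTo (n + 1) (G.mgInc π c g n) := by
  intro ω ω' h
  have h' : ∀ i ≤ n, ω i = ω' i := fun i hi => h i (hi.trans n.le_succ)
  simp only [mgInc, hc n ω ω' h', dependsUpTo_nextExp G π g n ω ω' h', h (n + 1) le_rfl]

/-- The martingale transform itself. -/
def mgSum (G : MDP S) (π : G.Strategy) (c : ℕ → (ℕ → S) → ℝ) (g : S → ℝ) (n : ℕ) (ω : ℕ → S) : ℝ :=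
  ∑ i ∈ Finset.range n, G.mgInc π c g i ω

theorem dependsUpTo_mgSum (G : MDP S) (π : G.Strategy) {c : ℕ → (ℕ → S) → ℝ} (g : S → ℝ)
    (hc : ∀ n, DependsUpTo n (c n)) (n : ℕ) : DependsUpTo n (G.mgSum π c g n) := by
  intro ω ω' h
  refine Finset.sum_congr rfl fun i hi => ?_
  exact dependsUpTo_mgInc G π g hc i ω ω' fun j hj => h j (hj.trans (Finset.mem_range.1 hi))

theorem abs_mgInc_le (G : MDP S) (π : G.Strategy) {c : ℕ → (ℕ → S) → ℝ} {g : S → ℝ} {C : ℝ}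
    (hc1 : ∀ n ω, |c n ω| ≤ 1) (hg : ∀ t, |g t| ≤ C) (n : ℕ) (ω : ℕ → S) :
    |G.mgInc π c g n ω| ≤ 2 * C := by
  have hC : 0 ≤ C := (abs_nonneg _).trans (hg (ω 0))
  rw [mgInc, abs_mul]
  have h1 : |g (ω (n + 1)) - G.nextExp π (hist ω n) (ω n) g| ≤ 2 * C := by
    have := abs_sub (g (ω (n + 1))) (G.nextExp π (hist ω n) (ω n) g)
    have := G.abs_nextExp_le π (hist ω n) (ω n) hg
    have := hg (ω (n + 1))
    linarith
  calc _ ≤ 1 * (2 * C) := mul_le_mul (hc1 n ω) h1 (abs_nonneg _) zero_le_one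
    _ = _ := one_mul _

end Finite

variable [Fintype S] [MeasurableSpace S] [MeasurableSingletonClass S]

instance (G : MDP S) (π : G.Strategy) (s : S) : IsProbabilityMeasure (G.law π s) := by
  unfold law; infer_instance

theorem DependsUpTo.measurable {α : Type*} [MeasurableSpace α] {n : ℕ} {F : (ℕ → S) → α}
    (hF : DependsUpTo n F) : Measurable F := by
  have h : F = (fun x => F (extend n x)) ∘ Preorder.frestrictLe n := by
    funext ω; exact hF.eq_extend ω
  rw [h]
  exact (measurable_of_finite _).comp (by fun_prop)

theorem DependsUpTo.integrable {n : ℕ} {F : (ℕ → S) → ℝ} (hF : DependsUpTo n F)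
    (μ : Measure (ℕ → S)) [IsFiniteMeasure μ] : Integrable F μ := by
  obtain ⟨C, hC⟩ := hF.exists_bound
  exact Integrable.of_bound hF.measurable.aestronglyMeasurable C (ae_of_all _ hC)

theorem integral_pmf (q : PMF S) (f : S → ℝ) :
    ∫ t, f t ∂q.toMeasure = ∑ t, (q t).toReal * f t := by
  rw [PMF.integral_eq_sum]; simp

/-- The tower property: the joint law of the history up to `n` and the next state is the
composition-product of the law of the history with the step kernel. -/
theorem integral_step (G : MDP S) (π : G.Strategy) (s : S) (n : ℕ) (F : (ℕ → S) → S → ℝ)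
    (hF : DependsUpTo n F) :
    ∫ ω, F ω (ω (n + 1)) ∂G.law π s =
      ∫ ω, G.nextExp π (hist ω n) (ω n) (F ω) ∂G.law π s := by
  set x₀ : Π _ : Finset.Iic 0, S := fun _ => s
  have key := Kernel.partialTraj_compProd_eq_map_traj (X := fun _ => S) (κ := G.stepKernel π)
    (Nat.zero_le n) (x₀ := x₀)
  have hmap := Kernel.traj_map_frestrictLe_apply (X := fun _ => S) (κ := G.stepKernel π) 0 n x₀
  have h1 : ∫ ω, F ω (ω (n + 1)) ∂G.law π s =
      ∫ z : (Π _ : Finset.Iic n, S) × S, F (extend n z.1) z.2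
        ∂((Kernel.traj (X := fun _ => S) (G.stepKernel π) 0 x₀).map
          (fun x ↦ (Preorder.frestrictLe n x, x (n + 1)))) := by
    rw [integral_map (by fun_prop) (measurable_of_finite _).aestronglyMeasurable]
    refine integral_congr_ae (ae_of_all _ fun ω => ?_)
    exact congrFun (hF.eq_extend ω) _
  rw [h1, ← key, Measure.integral_compProd
    (Integrable.of_finite), ← hmap,
    integral_map (by fun_prop) (measurable_of_finite _).aestronglyMeasurable]
  refine integral_congr_ae (ae_of_all _ fun ω => ?_)
  have := hF.eq_extend ω
  simp only [← this]
  simp only [stepKernel, Kernel.ofFunOfCountable, Kernel.coe_mk]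
  rw [integral_pmf]
  rfl

theorem law_zero (G : MDP S) (π : G.Strategy) (s : S) : ∀ᵐ ω ∂G.law π s, ω 0 = s := by
  set x₀ : Π _ : Finset.Iic 0, S := fun _ => s with hx
  have hmap := Kernel.traj_map_frestrictLe_apply (X := fun _ => S) (κ := G.stepKernel π) 0 0 x₀
  rw [Kernel.partialTraj_self, Kernel.id_apply] at hmap
  have h : ∀ᵐ x ∂(Measure.dirac x₀), x = x₀ := by
    rw [ae_dirac_eq]; exact rfl
  rw [← hmap] at h
  have := ae_of_ae_map (by fun_prop) h
  filter_upwards [this] with ω hω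
  exact congrFun hω ⟨0, by simp⟩

/-- Martingale orthogonality: the sum is known at time `n`, and the increment has conditional
expectation zero given the history. -/
theorem integral_mgSum_mul_mgInc (G : MDP S) (π : G.Strategy) {c : ℕ → (ℕ → S) → ℝ} (g : S → ℝ)
    (hc : ∀ n, DependsUpTo n (c n)) (s : S) (n : ℕ) :
    ∫ ω, G.mgSum π c g n ω * G.mgInc π c g n ω ∂G.law π s = 0 := by
  have := G.integral_step π s n
    (fun ω t => G.mgSum π c g n ω * (c n ω * (g t - G.nextExp π (hist ω n) (ω n) g))) (by
      intro ω ω' h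
      simp only [dependsUpTo_mgSum G π g hc n ω ω' h, hc n ω ω' h,
        dependsUpTo_nextExp G π g n ω ω' h])
  simp only [mgInc]
  rw [this]
  simp [nextExp_const_mul, nextExp_sub, nextExp_const]

/-- By orthogonality the second moments of the increments add up, and each is at most `(2 * C) ^ 2`.
-/
theorem integral_mgSum_sq_le (G : MDP S) (π : G.Strategy) {c : ℕ → (ℕ → S) → ℝ} {g : S → ℝ} {C : ℝ}
    (hc : ∀ n, DependsUpTo n (c n)) (hc1 : ∀ n ω, |c n ω| ≤ 1) (hg : ∀ t, |g t| ≤ C)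
    (s : S) (n : ℕ) :
    ∫ ω, G.mgSum π c g n ω ^ 2 ∂G.law π s ≤ (2 * C) ^ 2 * n := by
  induction n with
  | zero => simp [mgSum]
  | succ n ih =>
    have e : ∀ ω, G.mgSum π c g (n + 1) ω ^ 2 = G.mgSum π c g n ω ^ 2 +
        2 * (G.mgSum π c g n ω * G.mgInc π c g n ω) + G.mgInc π c g n ω ^ 2 := by
      intro ω
      simp only [mgSum, Finset.sum_range_succ]; ring
    have d1 : DependsUpTo (n + 1) (G.mgSum π c g n) := (dependsUpTo_mgSum G π g hc n).mono n.le_succ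
    have d2 := dependsUpTo_mgInc G π g hc n
    have i1 : Integrable (fun ω => G.mgSum π c g n ω ^ 2) (G.law π s) :=
      DependsUpTo.integrable (n := n + 1) (fun ω ω' h => by simp only [d1 ω ω' h]) _
    have i2 : Integrable (fun ω => 2 * (G.mgSum π c g n ω * G.mgInc π c g n ω)) (G.law π s) :=
      DependsUpTo.integrable (n := n + 1) (fun ω ω' h => by simp only [d1 ω ω' h, d2 ω ω' h]) _
    have i3 : Integrable (fun ω => G.mgInc π c g n ω ^ 2) (G.law π s) :=
      DependsUpTo.integrable (n := n + 1) (fun ω ω' h => by simp only [d2 ω ω' h]) _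
    simp only [e]
    have hadd : ∫ ω, (G.mgSum π c g n ω ^ 2 + 2 * (G.mgSum π c g n ω * G.mgInc π c g n ω) +
        G.mgInc π c g n ω ^ 2) ∂G.law π s = ∫ ω, G.mgSum π c g n ω ^ 2 ∂G.law π s +
        ∫ ω, 2 * (G.mgSum π c g n ω * G.mgInc π c g n ω) ∂G.law π s +
        ∫ ω, G.mgInc π c g n ω ^ 2 ∂G.law π s :=
      (integral_add (i1.add i2) i3).trans (congrArg (· + _) (integral_add i1 i2))
    rw [hadd, integral_const_mul, integral_mgSum_mul_mgInc G π g hc]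
    have : ∫ ω, G.mgInc π c g n ω ^ 2 ∂G.law π s ≤ ∫ _, (2 * C) ^ 2 ∂G.law π s :=
      integral_mono i3 (integrable_const _) fun ω =>
        sq_le_sq' (abs_le.1 (abs_mgInc_le G π hc1 hg n ω)).1 (abs_le.1 (abs_mgInc_le G π hc1 hg n ω)).2
    simp at this
    push_cast
    linarith

/-- The strong law of large numbers for bounded martingale transforms. -/
theorem ae_tendsto_mgSum_div (G : MDP S) (π : G.Strategy) {c : ℕ → (ℕ → S) → ℝ} (g : S → ℝ)
    (hc : ∀ n, DependsUpTo n (c n)) (hc1 : ∀ n ω, |c n ω| ≤ 1) (s : S) :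
    ∀ᵐ ω ∂G.law π s, Tendsto (fun n : ℕ => G.mgSum π c g n ω / n) atTop (nhds 0) := by
  obtain ⟨C, hg⟩ : ∃ C, ∀ t, |g t| ≤ C :=
    ⟨∑ t, |g t|, fun t => Finset.single_le_sum (f := fun t => |g t|)
      (fun _ _ => abs_nonneg _) (Finset.mem_univ t)⟩
  -- Along the squares the second moments are `O(1 / k ^ 2)`, hence summable. So `∑ X k` is finite
  -- almost surely and `X k → 0`; bounded increments fill the gaps between squares.
  set X : ℕ → (ℕ → S) → ℝ := fun k ω => (G.mgSum π c g (k ^ 2) ω / (k : ℝ) ^ 2) ^ 2 with hX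
  have hXm : ∀ k, Measurable (X k) := fun k =>
    (((dependsUpTo_mgSum G π g hc (k ^ 2)).measurable).div_const _).pow_const 2
  have hXi : ∀ k, Integrable (X k) (G.law π s) := fun k =>
    DependsUpTo.integrable (n := k ^ 2)
      (fun ω ω' h => by simp only [hX, dependsUpTo_mgSum G π g hc (k ^ 2) ω ω' h]) _
  have hle : ∀ k, ∫ ω, X k ω ∂G.law π s ≤ (2 * C) ^ 2 * (1 / (k : ℝ) ^ 2) := by
    intro k
    rcases Nat.eq_zero_or_pos k with rfl | hk
    · simp [hX]
    have hk' : (0 : ℝ) < k := by exact_mod_cast hk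
    have h := integral_mgSum_sq_le G π hc hc1 hg s (k ^ 2)
    simp only [hX, div_pow]
    rw [integral_div, div_le_iff₀ (by positivity)]
    refine h.trans (le_of_eq ?_)
    push_cast
    field_simp
  have hsum : Summable fun k : ℕ => (2 * C) ^ 2 * (1 / (k : ℝ) ^ 2) :=
    (Real.summable_one_div_nat_pow.2 one_lt_two).mul_left _
  have hfin : ∫⁻ ω, ∑' k, ENNReal.ofReal (X k ω) ∂G.law π s ≠ ⊤ := by
    rw [lintegral_tsum fun k => (hXm k).ennreal_ofReal.aemeasurable]
    refine ne_top_of_le_ne_top hsum.tsum_ofReal_ne_top (ENNReal.tsum_le_tsum fun k => ?_)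
    rw [← ofReal_integral_eq_lintegral_ofReal (hXi k) (ae_of_all _ fun ω => sq_nonneg _)]
    exact ENNReal.ofReal_le_ofReal (hle k)
  have hae := ae_lt_top' (Measurable.tsum fun k => (hXm k).ennreal_ofReal).aemeasurable hfin
  filter_upwards [hae] with ω hω
  have h1 := ENNReal.tendsto_atTop_zero_of_tsum_ne_top hω.ne
  refine tendsto_div_of_sq (C := 2 * C) (fun n => ?_) ?_
  · simp only [mgSum, Finset.sum_range_succ, add_sub_cancel_left]
    exact abs_mgInc_le G π hc1 hg n ω
  · have h2 := (ENNReal.tendsto_toReal ENNReal.zero_ne_top).comp h1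
    simp only [Function.comp_def, ENNReal.toReal_zero] at h2
    have h3 : Tendsto (fun k => X k ω) atTop (nhds 0) :=
      h2.congr fun k => ENNReal.toReal_ofReal (sq_nonneg _)
    have h4 := h3.sqrt
    simp only [hX, Real.sqrt_sq_eq_abs, Real.sqrt_zero] at h4
    exact (tendsto_zero_iff_abs_tendsto_zero _).2 h4

end MDP

/-! ### The average reward optimality equation, by vanishing discount. -/

namespace MDP

variable {S : Type*}

theorem nextState_edge {G : MDP S} (π : G.Strategy) (v : List S) {s t : S}
    (h : G.nextState π v s t ≠ 0) : G.edge s t := by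
  unfold nextState at h
  split_ifs at h with hs
  · exact π.available v ⟨s, hs⟩ t h
  · exact (G.edge_iff ⟨s, hs⟩ t).2 h

theorem IsEndComponent.reflTransGen {G : MDP S} (hEC : G.IsEndComponent Set.univ) (s t : S) :
    Relation.ReflTransGen G.edge s t :=
  Relation.ReflTransGen.mono (fun _ _ h => h.2.2) _ _ (hEC.2.2 s trivial t trivial).to_reflTransGen

section Optimality

variable [Fintype S]

open Classical in
/-- The states that can follow `s`. -/
def successors (G : MDP S) (s : S) : Finset S := Finset.univ.filter (G.edge s)

theorem mem_successors {G : MDP S} {s t : S} : t ∈ G.successors s ↔ G.edge s t := by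
  simp [successors]

theorem successors_nonempty (G : MDP S) (s : S) : (G.successors s).Nonempty :=
  (G.exists_edge s).imp fun _ => mem_successors.2

open Classical in
/-- The best expectation of `f` after one move from `s`. -/
def opt (G : MDP S) (f : S → ℝ) (s : S) : ℝ :=
  if h : s ∈ G.player then (G.successors s).sup' (G.successors_nonempty s) f
  else ∑ t, (G.trans ⟨s, h⟩ t).toReal * f t

/-- This single inequality encodes monotonicity, compatibility with constants and nonexpansiveness
in the sup norm. -/
theorem opt_le_add (G : MDP S) {f g : S → ℝ} {c : ℝ} (h : ∀ s, f s ≤ g s + c) (s : S) :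
    G.opt f s ≤ G.opt g s + c := by
  unfold opt
  split_ifs with hs
  · refine Finset.sup'_le _ _ fun t ht => (h t).trans ?_
    gcongr
    exact Finset.le_sup' g ht
  · calc _ ≤ ∑ t, (G.trans ⟨s, hs⟩ t).toReal * (g t + c) :=
          Finset.sum_le_sum fun t _ => mul_le_mul_of_nonneg_left (h t) ENNReal.toReal_nonneg
      _ = _ := by
          simp only [mul_add, Finset.sum_add_distrib, ← Finset.sum_mul, sum_toReal_pmf, one_mul]

theorem opt_sub_const (G : MDP S) (f : S → ℝ) (c : ℝ) (s : S) :
    G.opt (fun t => f t - c) s = G.opt f s - c := by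
  have h1 := G.opt_le_add (f := fun t => f t - c) (g := f) (c := -c) (fun t => by linarith) s
  have h2 := G.opt_le_add (f := f) (g := fun t => f t - c) (c := c) (fun t => by linarith) s
  linarith

theorem opt_const (G : MDP S) (c : ℝ) (s : S) : G.opt (fun _ => c) s = c := by
  unfold opt
  split_ifs with hs
  · simp
  · simp [← Finset.sum_mul, sum_toReal_pmf]

theorem le_opt (G : MDP S) {f : S → ℝ} {c : ℝ} (h : ∀ s, c ≤ f s) (s : S) : c ≤ G.opt f s := by
  have := G.opt_le_add (f := fun _ => c) (g := f) (c := 0) (fun t => by linarith [h t]) s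
  rw [opt_const] at this
  linarith

theorem opt_le (G : MDP S) {f : S → ℝ} {c : ℝ} (h : ∀ s, f s ≤ c) (s : S) : G.opt f s ≤ c := by
  have := G.opt_le_add (g := fun _ => c) (f := f) (c := 0) (fun t => by linarith [h t]) s
  rw [opt_const] at this
  linarith

theorem lipschitzWith_opt (G : MDP S) : LipschitzWith 1 G.opt := by
  refine LipschitzWith.of_dist_le_mul fun f g => ?_
  rw [NNReal.coe_one, one_mul]
  refine (dist_pi_le_iff dist_nonneg).2 fun s => ?_
  have hfg : ∀ t, |f t - g t| ≤ dist f g := fun t => dist_le_pi_dist f g t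
  rw [Real.dist_eq, abs_le]
  have h1 := G.opt_le_add (f := f) (g := g) (c := dist f g)
    (fun t => by linarith [(abs_le.1 (hfg t)).2]) s
  have h2 := G.opt_le_add (f := g) (g := f) (c := dist f g)
    (fun t => by linarith [(abs_le.1 (hfg t)).1]) s
  constructor <;> linarith

/-- A nonnegative function is controlled at the successors of `s` by its best expectation. -/
theorem exists_mul_le_opt (G : MDP S) {s t : S} (h : G.edge s t) :
    ∃ c : ℝ, 0 < c ∧ ∀ f : S → ℝ, (∀ u, 0 ≤ f u) → c * f t ≤ G.opt f s := by
  by_cases hs : s ∈ G.player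
  · refine ⟨1, one_pos, fun f _ => ?_⟩
    rw [opt, dif_pos hs, one_mul]
    exact Finset.le_sup' f (mem_successors.2 h)
  · refine ⟨(G.trans ⟨s, hs⟩ t).toReal,
      ENNReal.toReal_pos ((G.edge_iff ⟨s, hs⟩ t).1 h) (PMF.apply_ne_top _ _), fun f hf => ?_⟩
    rw [opt, dif_neg hs]
    exact Finset.single_le_sum (f := fun u => (G.trans ⟨s, hs⟩ u).toReal * f u)
      (fun u _ => mul_nonneg ENNReal.toReal_nonneg (hf u)) (Finset.mem_univ t)

/-- `V` solves the optimality equation for the discount factor `d`. -/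
def IsDiscountedValue (G : MDP S) (r : S → ℝ) (d : ℝ) (V : S → ℝ) : Prop :=
  ∀ s, V s = r s + d * G.opt V s

/-- Banach's fixed point theorem: `opt` is nonexpansive, so discounting makes it a contraction. -/
theorem exists_isDiscountedValue (G : MDP S) (r : S → ℝ) {d : ℝ} (h0 : 0 ≤ d) (h1 : d < 1) :
    ∃ V, G.IsDiscountedValue r d V := by
  have hT : ContractingWith ⟨d, h0⟩ fun V : S → ℝ => r + d • G.opt V := by
    refine ⟨by exact_mod_cast h1, LipschitzWith.of_dist_le_mul fun f g => ?_⟩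
    rw [dist_add_left, dist_smul₀, Real.norm_of_nonneg h0]
    have := G.lipschitzWith_opt.dist_le_mul f g
    rw [NNReal.coe_one, one_mul] at this
    exact mul_le_mul_of_nonneg_left this h0
  exact ⟨hT.fixedPoint _, fun s => (congrFun hT.fixedPoint_isFixedPt s).symm⟩

theorem IsDiscountedValue.abs_mul_le {G : MDP S} {r : S → ℝ} {d R : ℝ} {V : S → ℝ}
    (hV : G.IsDiscountedValue r d V) (h0 : 0 ≤ d) (h1 : d < 1) (hr : ∀ s, |r s| ≤ R) (s : S) :
    |(1 - d) * V s| ≤ R := by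
  have : Nonempty S := ⟨s⟩
  obtain ⟨a, ha⟩ := Finite.exists_max V
  obtain ⟨b, hb⟩ := Finite.exists_min V
  have h2 : (1 - d) * V a ≤ R := by
    have := mul_le_mul_of_nonneg_left (G.opt_le ha a) h0
    have := (abs_le.1 (hr a)).2
    linarith [hV a]
  have h3 : -R ≤ (1 - d) * V b := by
    have := mul_le_mul_of_nonneg_left (G.le_opt hb b) h0
    have := (abs_le.1 (hr b)).1
    linarith [hV b]
  have h4 := mul_le_mul_of_nonneg_left (ha s) (sub_pos.2 h1).le
  have h5 := mul_le_mul_of_nonneg_left (hb s) (sub_pos.2 h1).le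
  exact abs_le.2 ⟨by linarith, by linarith⟩

/-- The point is that `D` does not depend on `d`. Since `s` minimizes `V`, the function `V - V s` is
nonnegative, so an edge from `b` to `t` gives `c * (V t - V s) ≤ opt V b - V s`. By the discounted
equation, `d` times the right side equals `(V b - V s) + (1 - d) * V s - r b`, at most `|D| + 2 * R`
for the bound `D` at `b`; and `d ≥ 1 / 2` costs a factor 2. -/
theorem exists_discounted_bound_of_reachable (G : MDP S) {r : S → ℝ} {R : ℝ} (hr : ∀ s, |r s| ≤ R)
    {s t : S} (hst : Relation.ReflTransGen G.edge s t) :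
    ∃ D, ∀ d V, 1 / 2 ≤ d → d < 1 → G.IsDiscountedValue r d V → (∀ u, V s ≤ V u) →
      V t - V s ≤ D := by
  induction hst with
  | refl => exact ⟨0, fun d V _ _ _ _ => by simp⟩
  | @tail b t _ hbt ih =>
    obtain ⟨D, hD⟩ := ih
    obtain ⟨c, hc, hopt⟩ := G.exists_mul_le_opt hbt
    refine ⟨2 * (|D| + 2 * R) / c, fun d V hd hd1 hV hmin => ?_⟩
    have h1 := hD d V hd hd1 hV hmin
    have h2 := hopt (fun u => V u - V s) fun u => sub_nonneg.2 (hmin u)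
    rw [opt_sub_const] at h2
    have h3 := hV b
    have h4 := (abs_le.1 (hV.abs_mul_le (by linarith) hd1 hr s)).2
    have h5 := (abs_le.1 (hr b)).1
    have h6 : d * (G.opt V b - V s) ≤ |D| + 2 * R := by
      have := le_abs_self D
      nlinarith
    have h7 : 0 ≤ G.opt V b - V s := sub_nonneg.2 (G.le_opt hmin b)
    rw [le_div_iff₀ hc]
    nlinarith

theorem exists_discounted_bound (G : MDP S) (hEC : G.IsEndComponent Set.univ) {r : S → ℝ} {R : ℝ}
    (hr : ∀ s, |r s| ≤ R) :
    ∃ D, ∀ d V, 1 / 2 ≤ d → d < 1 → G.IsDiscountedValue r d V → ∀ s t, |V s - V t| ≤ D := by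
  choose D hD using fun s t => G.exists_discounted_bound_of_reachable hr (hEC.reflTransGen s t)
  refine ⟨∑ s, ∑ t, |D s t|, fun d V hd hd1 hV s t => ?_⟩
  have : Nonempty S := ⟨s⟩
  obtain ⟨b, hb⟩ := Finite.exists_min V
  have key : ∀ u, V u - V b ≤ ∑ s, ∑ t, |D s t| := fun u =>
    calc V u - V b ≤ D b u := hD b u d V hd hd1 hV hb
      _ ≤ |D b u| := le_abs_self _
      _ ≤ ∑ t, |D b t| :=
        Finset.single_le_sum (f := fun t => |D b t|) (fun _ _ => abs_nonneg _) (Finset.mem_univ u)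
      _ ≤ _ := Finset.single_le_sum (f := fun s => ∑ t, |D s t|)
        (fun _ _ => Finset.sum_nonneg fun _ _ => abs_nonneg _) (Finset.mem_univ b)
  exact abs_le.2 ⟨by linarith [key t, hb s], by linarith [key s, hb t]⟩

theorem exists_abs_le (r : S → ℝ) : ∃ R, ∀ s, |r s| ≤ R :=
  ⟨∑ t, |r t|, fun t => Finset.single_le_sum (f := fun t => |r t|)
      (fun _ _ => abs_nonneg _) (Finset.mem_univ t)⟩

/-- The average reward optimality equation of a strongly connected Markov decision process. -/
theorem exists_optimality_equation (G : MDP S) (hEC : G.IsEndComponent Set.univ) (r : S → ℝ) :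
    ∃ (v : ℝ) (h : S → ℝ), ∀ s, h s + v = r s + G.opt h s := by
  obtain ⟨R, hr⟩ := exists_abs_le r
  obtain ⟨D, hD⟩ := G.exists_discounted_bound hEC hr
  set d : ℕ → ℝ := fun n => 1 - 1 / ((n : ℝ) + 2) with hd
  have hd1 : ∀ n, d n < 1 := fun n => by
    have : (0 : ℝ) < 1 / ((n : ℝ) + 2) := by positivity
    simp only [hd]; linarith
  have hd2 : ∀ n, 1 / 2 ≤ d n := fun n => by
    have : 1 / ((n : ℝ) + 2) ≤ 1 / 2 :=
      one_div_le_one_div_of_le two_pos (by linarith [Nat.cast_nonneg (α := ℝ) n])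
    simp only [hd]; linarith
  have hd3 : Tendsto d atTop (nhds 1) := by
    have h : Tendsto (fun n : ℕ => 1 / ((n : ℝ) + 2)) atTop (nhds 0) := by
      have := (tendsto_add_atTop_iff_nat 2).2 (tendsto_one_div_atTop_nhds_zero_nat (𝕜 := ℝ))
      simpa using this
    have := h.const_sub 1
    rwa [sub_zero] at this
  choose V hV using fun n => G.exists_isDiscountedValue r (by linarith [hd2 n]) (hd1 n)
  -- The values themselves may blow up as `d → 1`. The relative values and the normalized value at
  -- `G.init` stay bounded, and satisfy the discounted equation in the form `heq` below; any limit
  -- point solves the optimality equation.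
  set x : ℕ → (S → ℝ) × ℝ := fun n =>
    (fun s => V n s - V n G.init, (1 - d n) * V n G.init) with hx
  have hxb : ∀ n, x n ∈ Metric.closedBall (0 : (S → ℝ) × ℝ) (max |D| |R|) := by
    intro n
    rw [mem_closedBall_zero_iff, Prod.norm_def]
    refine max_le_max ?_ ?_
    · refine (pi_norm_le_iff_of_nonneg (abs_nonneg _)).2 fun s => ?_
      exact (hD _ _ (hd2 n) (hd1 n) (hV n) s _).trans (le_abs_self _)
    · exact ((hV n).abs_mul_le (by linarith [hd2 n]) (hd1 n) hr _).trans (le_abs_self _)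
  obtain ⟨⟨h, v⟩, -, φ, hφ, hlim⟩ := (isCompact_closedBall _ _).tendsto_subseq hxb
  refine ⟨v, h, fun s => ?_⟩
  have hl1 : Tendsto (fun n => (x (φ n)).1) atTop (nhds h) := (continuous_fst.tendsto _).comp hlim
  have hl2 : Tendsto (fun n => (x (φ n)).2) atTop (nhds v) := (continuous_snd.tendsto _).comp hlim
  have hopt : Tendsto (fun n => G.opt (x (φ n)).1 s) atTop (nhds (G.opt h s)) :=
    (((continuous_apply s).comp G.lipschitzWith_opt.continuous).tendsto h).comp hl1
  have heq : ∀ n, (x n).1 s + (x n).2 = r s + d n * G.opt (x n).1 s := by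
    intro n
    have h1 := hV n s
    simp only [hx, opt_sub_const]
    linarith
  refine tendsto_nhds_unique (((continuous_apply s).tendsto h).comp hl1 |>.add hl2) ?_
  have := ((hd3.comp hφ.tendsto_atTop).mul hopt).const_add (r s)
  rw [one_mul] at this
  exact this.congr fun n => (heq (φ n)).symm

theorem nextExp_le_opt (G : MDP S) (π : G.Strategy) (v : List S) (s : S) (f : S → ℝ) :
    G.nextExp π v s f ≤ G.opt f s := by
  by_cases hs : s ∈ G.player
  · rw [opt, dif_pos hs, ← G.nextExp_const π v s (Finset.sup' _ _ f)]
    refine Finset.sum_le_sum fun t _ => ?_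
    by_cases ht : G.nextState π v s t = 0
    · simp [ht]
    · exact mul_le_mul_of_nonneg_left
        (Finset.le_sup' f (mem_successors.2 (nextState_edge π v ht))) ENNReal.toReal_nonneg
  · rw [opt, dif_neg hs, nextExp, nextState, dif_neg hs]

theorem nextExp_pureMemoryless (G : MDP S) (σ : G.PureMemoryless) (v : List S) {s : S}
    (hs : s ∈ G.player) (f : S → ℝ) : G.nextExp σ.toStrategy v s f = f (σ.move ⟨s, hs⟩) := by
  classical
  rw [nextExp, nextState, dif_pos hs]
  simp only [PureMemoryless.toStrategy, PMF.pure_apply]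
  rw [Finset.sum_eq_single (σ.move ⟨s, hs⟩)] <;> simp +contextual

/-- A greedy pure memoryless strategy attains the best one-step expectations of `f`. -/
theorem exists_greedy (G : MDP S) (f : S → ℝ) :
    ∃ σ : G.PureMemoryless, ∀ v s, G.nextExp σ.toStrategy v s f = G.opt f s := by
  choose t ht hft using fun s => Finset.exists_mem_eq_sup' (G.successors_nonempty s) f
  refine ⟨⟨fun s => t s, fun s => mem_successors.1 (ht s)⟩, fun v s => ?_⟩
  by_cases hs : s ∈ G.player
  · rw [nextExp_pureMemoryless _ _ _ hs, opt, dif_pos hs, hft s]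
  · rw [opt, dif_neg hs, nextExp, nextState, dif_neg hs]

/-- If some state has positive reward and no state has negative reward, then the optimal average
reward is positive. -/
theorem pos_of_optimality_equation {G : MDP S} (hEC : G.IsEndComponent Set.univ) {r h : S → ℝ}
    {v : ℝ} (heq : ∀ s, h s + v = r s + G.opt h s) (hr : ∀ s, 0 ≤ r s) {t : S} (ht : 0 < r t) :
    0 < v := by
  by_contra! hv
  have : Nonempty S := ⟨t⟩
  obtain ⟨b, hb⟩ := Finite.exists_min h
  -- At a minimizer `a` of `h`, `v ≤ 0 ≤ r a` gives `opt h a ≤ h a`, so every successor of `a` is a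
  -- minimizer too. By connectivity `h` is constant, which contradicts the equation at `t`.
  have hall : ∀ u, h u = h b := by
    intro u
    have hbu := hEC.reflTransGen b u
    induction hbu with
    | refl => rfl
    | @tail a u _ hau ih =>
      obtain ⟨c, hc, hopt⟩ := G.exists_mul_le_opt hau
      have h1 := hopt (fun u => h u - h b) fun u => sub_nonneg.2 (hb u)
      rw [opt_sub_const] at h1
      have h2 : c * (h u - h b) ≤ 0 := by linarith [heq a, hr a]
      have h3 := hb u
      nlinarith [mul_nonneg hc.le (sub_nonneg.2 h3)]
  have h1 := G.le_opt hb t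
  linarith [heq t, hall t]

end Optimality

end MDP

/-! ### Average rewards: the mean-payoff value and almost sure reachability. -/

namespace MDP

variable {S : Type*}

/-- The average reward of the first `n` states of a play. -/
def average (r : S → ℝ) (n : ℕ) (ω : ℕ → S) : ℝ := (∑ i ∈ Finset.range n, r (ω i)) / (n : ℝ)

theorem abs_average_le {r : S → ℝ} {R : ℝ} (hr : ∀ s, |r s| ≤ R) (n : ℕ) (ω : ℕ → S) :
    |average r n ω| ≤ R := by
  have hR : 0 ≤ R := (abs_nonneg _).trans (hr (ω 0))
  rw [average, abs_div, Nat.abs_cast]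
  refine div_le_of_le_mul₀ (Nat.cast_nonneg _) hR ?_
  calc _ ≤ ∑ i ∈ Finset.range n, |r (ω i)| := Finset.abs_sum_le_sum_abs _ _
    _ ≤ ∑ i ∈ Finset.range n, R := Finset.sum_le_sum fun i _ => hr _
    _ = R * n := by simp [mul_comm]

theorem dependsUpTo_average (r : S → ℝ) (n : ℕ) : DependsUpTo n (average r n) := by
  intro ω ω' h
  unfold average
  rw [Finset.sum_congr rfl fun i hi => by rw [h i (Finset.mem_range.1 hi).le]]

theorem meanPayoff_eq (r : S → ℝ) (ω : ℕ → S) :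
    meanPayoff r ω = ((liminf (fun n => average r n ω) atTop : ℝ) : WithBot ℝ) := rfl

/-- The expected lower limit of a bounded sequence is the limit of lower bounds of the
expectations. -/
theorem exists_tendsto_integral_liminf {Ω : Type*} [MeasurableSpace Ω] (μ : Measure Ω)
    [IsProbabilityMeasure μ] {A : ℕ → Ω → ℝ} {R : ℝ} (hm : ∀ n, Measurable (A n))
    (hA : ∀ n ω, |A n ω| ≤ R) :
    ∃ b : ℕ → ℝ, (∀ n, b n ≤ ∫ ω, A n ω ∂μ) ∧
      Tendsto b atTop (nhds (∫ ω, liminf (fun n => A n ω) atTop ∂μ)) := by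
  -- The tail infima increase to the lower limit and are bounded by `R`, so dominated convergence
  -- applies to them.
  set B : ℕ → Ω → ℝ := fun n ω => ⨅ i, A (i + n) ω with hB
  have hbdd : ∀ n ω, BddBelow (Set.range fun i => A (i + n) ω) := fun n ω =>
    ⟨-R, by rintro _ ⟨i, rfl⟩; exact (abs_le.1 (hA _ _)).1⟩
  have hBA : ∀ n m ω, n ≤ m → B n ω ≤ A m ω := by
    intro n m ω hnm
    have := ciInf_le (hbdd n ω) (m - n)
    rwa [Nat.sub_add_cancel hnm] at this
  have hBm : ∀ n, Measurable (B n) := fun n => Measurable.iInf fun i => hm (i + n)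
  have hBR : ∀ n ω, |B n ω| ≤ R := fun n ω =>
    abs_le.2 ⟨le_ciInf fun i => (abs_le.1 (hA _ _)).1,
      (hBA n n ω le_rfl).trans (abs_le.1 (hA _ _)).2⟩
  have hBi : ∀ n, Integrable (B n) μ := fun n =>
    Integrable.of_bound (hBm n).aestronglyMeasurable R (ae_of_all _ (hBR n))
  have hAi : ∀ n, Integrable (A n) μ := fun n =>
    Integrable.of_bound (hm n).aestronglyMeasurable R (ae_of_all _ (hA n))
  refine ⟨fun n => ∫ ω, B n ω ∂μ,
    fun n => integral_mono (hBi n) (hAi n) fun ω => hBA n n ω le_rfl, ?_⟩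
  refine tendsto_integral_of_dominated_convergence (fun _ => R)
    (fun n => (hBm n).aestronglyMeasurable) (integrable_const _)
    (fun n => ae_of_all _ (hBR n)) (ae_of_all _ fun ω => ?_)
  have hb1 : IsBoundedUnder (· ≥ ·) atTop fun n => A n ω :=
    isBoundedUnder_of ⟨-R, fun n => (abs_le.1 (hA n ω)).1⟩
  have hb2 : IsCoboundedUnder (· ≥ ·) atTop fun n => A n ω :=
    (isBoundedUnder_of ⟨R, fun n => (abs_le.1 (hA n ω)).2⟩ :
      IsBoundedUnder (· ≤ ·) atTop fun n => A n ω).isCoboundedUnder_ge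
  refine tendsto_order.2 ⟨fun a ha => ?_, fun a ha => Eventually.of_forall fun n => ?_⟩
  · obtain ⟨a', haa', ha'⟩ := exists_between ha
    obtain ⟨N, hN⟩ := eventually_atTop.1 (eventually_lt_of_lt_liminf ha' hb1)
    filter_upwards [eventually_ge_atTop N] with n hn
    exact haa'.trans_le (le_ciInf fun i => (hN _ (by omega)).le)
  · refine lt_of_le_of_lt (le_liminf_of_le hb2 ?_) ha
    filter_upwards [eventually_ge_atTop n] with m hm
    exact hBA n m ω hm

variable [Fintype S]

/-- Telescoping: replacing the expected next value of `h` by the actual one costs a martingale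
increment, and the last sum collects the errors in the Poisson equation. -/
theorem sum_reward_eq (G : MDP S) (π : G.Strategy) (r h : S → ℝ) (v : ℝ) (ω : ℕ → S) (n : ℕ) :
    ∑ i ∈ Finset.range n, r (ω i) = n * v + h (ω 0) - h (ω n) +
      G.mgSum π (fun _ _ => 1) h n ω +
      ∑ i ∈ Finset.range n, (r (ω i) + G.nextExp π (hist ω i) (ω i) h - h (ω i) - v) := by
  induction n with
  | zero => simp [mgSum]
  | succ n ih =>
    rw [Finset.sum_range_succ, ih, Finset.sum_range_succ, mgSum, mgSum, Finset.sum_range_succ, mgInc]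
    push_cast
    ring

variable [MeasurableSpace S] [MeasurableSingletonClass S]

/-- If the errors in the Poisson equation for `h` and `v` vanish on average, then the average
rewards converge to `v`. -/
theorem ae_tendsto_average (G : MDP S) (π : G.Strategy) (r h : S → ℝ) (v : ℝ) (s : S) :
    ∀ᵐ ω ∂G.law π s, Tendsto (fun n : ℕ => (∑ i ∈ Finset.range n,
        (r (ω i) + G.nextExp π (hist ω i) (ω i) h - h (ω i) - v)) / n) atTop (nhds 0) →
      Tendsto (fun n => average r n ω) atTop (nhds v) := by
  obtain ⟨H, hH⟩ := exists_abs_le h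
  filter_upwards [G.ae_tendsto_mgSum_div π (c := fun _ _ => 1) h (fun _ _ _ _ => rfl)
    (fun _ _ => by simp) s] with ω hω he
  have hb : Tendsto (fun n : ℕ => (h (ω 0) - h (ω n)) / n) atTop (nhds 0) := by
    refine squeeze_zero_norm (a := fun n : ℕ => 2 * H / n) (fun n => ?_)
      (tendsto_const_div_atTop_nhds_zero_nat _)
    rw [Real.norm_eq_abs, abs_div, Nat.abs_cast]
    gcongr
    have := abs_sub (h (ω 0)) (h (ω n))
    linarith [hH (ω 0), hH (ω n)]
  have hlim := ((hb.add hω).add he).const_add v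
  simp only [add_zero] at hlim
  refine hlim.congr' ?_
  filter_upwards [eventually_ge_atTop 1] with n hn
  have hn' : (n : ℝ) ≠ 0 := by positivity
  rw [average, sum_reward_eq G π r h v ω n]
  field_simp
  ring

theorem expectation_eq_of_ae_tendsto (G : MDP S) (π : G.Strategy) (s : S) {r : S → ℝ} {v : ℝ}
    {f : (ℕ → S) → WithBot ℝ} (hf : ∀ᵐ ω ∂G.law π s, f ω = meanPayoff r ω)
    (h : ∀ᵐ ω ∂G.law π s, Tendsto (fun n => average r n ω) atTop (nhds v)) :
    G.expectation π s f = v := by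
  have h1 : ∀ᵐ ω ∂G.law π s, f ω = (v : WithBot ℝ) := by
    filter_upwards [hf, h] with ω h1 h2
    rw [h1, meanPayoff_eq, h2.liminf_eq]
  rw [expectation, if_pos (h1.mono fun ω hω => by rw [hω]; exact WithBot.coe_ne_bot)]
  rw [integral_congr_ae (g := fun _ => v) (h1.mono fun ω hω => by simp [hω])]
  simp

theorem expectation_meanPayoff (G : MDP S) (π : G.Strategy) (s : S) (r : S → ℝ) :
    G.expectation π s (meanPayoff r) =
      ((∫ ω, liminf (fun n => average r n ω) atTop ∂G.law π s : ℝ) : EReal) := by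
  rw [expectation, if_pos (ae_of_all _ fun ω =>
    show meanPayoff r ω ≠ ⊥ from WithBot.coe_ne_bot)]
  rfl

/-- No strategy has a one-step expectation of `h` above `opt h`, so in expectation each reward is at
most `v` plus a telescoping difference of `h`. -/
theorem integral_average_le {G : MDP S} {r h : S → ℝ} {v H : ℝ}
    (heq : ∀ s, h s + v = r s + G.opt h s) (hH : ∀ s, |h s| ≤ H) (π : G.Strategy) (s : S) {n : ℕ}
    (hn : 0 < n) : ∫ ω, average r n ω ∂G.law π s ≤ v + 2 * H / n := by
  have hi : ∀ (f : S → ℝ) (i : ℕ), Integrable (fun ω : ℕ → S => f (ω i)) (G.law π s) := fun f i =>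
    DependsUpTo.integrable (n := i) (fun ω ω' h => by simp only [h i le_rfl]) _
  have hstep : ∀ i, ∫ ω, r (ω i) ∂G.law π s ≤
      v + ∫ ω, h (ω i) ∂G.law π s - ∫ ω, h (ω (i + 1)) ∂G.law π s := by
    intro i
    have h1 := G.integral_step π s i (fun _ => h) (fun _ _ _ => rfl)
    have h2 : ∫ ω, r (ω i) ∂G.law π s ≤
        ∫ ω, ((h (ω i) + v) - G.nextExp π (hist ω i) (ω i) h) ∂G.law π s := by
      refine integral_mono (hi r i) (((hi h i).add (integrable_const v)).sub
        ((dependsUpTo_nextExp G π h i).integrable _)) fun ω => ?_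
      have := G.nextExp_le_opt π (hist ω i) (ω i) h
      have := heq (ω i)
      simp only
      linarith
    have h3 : ∫ ω, ((h (ω i) + v) - G.nextExp π (hist ω i) (ω i) h) ∂G.law π s =
        ∫ ω, h (ω i) ∂G.law π s + ∫ _, v ∂G.law π s -
          ∫ ω, G.nextExp π (hist ω i) (ω i) h ∂G.law π s :=
      (integral_sub ((hi h i).add (integrable_const v))
        ((dependsUpTo_nextExp G π h i).integrable _)).trans
        (congrArg (· - _) (integral_add (hi h i) (integrable_const v)))
    rw [h3, ← h1] at h2
    simp only [integral_const, probReal_univ, one_smul] at h2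
    linarith
  have hsum : ∀ n : ℕ, ∑ i ∈ Finset.range n, ∫ ω, r (ω i) ∂G.law π s ≤
      n * v + ∫ ω, h (ω 0) ∂G.law π s - ∫ ω, h (ω n) ∂G.law π s := by
    intro n
    induction n with
    | zero => simp
    | succ n ih =>
      rw [Finset.sum_range_succ]
      push_cast
      linarith [hstep n]
  have hbd : ∀ i, |∫ ω, h (ω i) ∂G.law π s| ≤ H := by
    intro i
    have := norm_integral_le_of_norm_le_const (μ := G.law π s) (f := fun ω => h (ω i))
      (ae_of_all _ fun ω => hH (ω i))
    simpa using this
  unfold average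
  rw [integral_div, integral_finsetSum _ fun i _ => hi r i]
  have hn' : (0 : ℝ) < n := by exact_mod_cast hn
  rw [div_le_iff₀ hn', add_mul, div_mul_cancel₀ _ hn'.ne']
  linarith [hsum n, (abs_le.1 (hbd 0)).2, (abs_le.1 (hbd n)).1]

theorem integral_liminf_average_le {G : MDP S} {r h : S → ℝ} {v : ℝ}
    (heq : ∀ s, h s + v = r s + G.opt h s) (π : G.Strategy) (s : S) :
    ∫ ω, liminf (fun n => average r n ω) atTop ∂G.law π s ≤ v := by
  obtain ⟨H, hH⟩ := exists_abs_le h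
  obtain ⟨R, hR⟩ := exists_abs_le r
  obtain ⟨b, hb, hlim⟩ := exists_tendsto_integral_liminf (G.law π s)
    (fun n => (dependsUpTo_average r n).measurable) (abs_average_le hR)
  have h2 : Tendsto (fun n : ℕ => v + 2 * H / n) atTop (nhds v) := by
    simpa using (tendsto_const_div_atTop_nhds_zero_nat (2 * H)).const_add v
  refine le_of_tendsto_of_tendsto hlim h2 ?_
  filter_upwards [eventually_ge_atTop 1] with n hn
  exact (hb n).trans (integral_average_le heq hH π s hn)

theorem expectation_meanPayoff_le {G : MDP S} {r h : S → ℝ} {v : ℝ}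
    (heq : ∀ s, h s + v = r s + G.opt h s) (π : G.Strategy) (s : S) :
    G.expectation π s (meanPayoff r) ≤ v := by
  rw [expectation_meanPayoff]
  exact_mod_cast integral_liminf_average_le heq π s

/-- Optimality concerns only the expected lower limit, but this bounds the expected averages from
below, and the bound valid for all strategies squeezes them from above. -/
theorem tendsto_integral_average {G : MDP S} {r h : S → ℝ} {v : ℝ}
    (heq : ∀ s, h s + v = r s + G.opt h s) {π : G.Strategy} {s : S}
    (hπ : G.expectation π s (meanPayoff r) = v) :
    Tendsto (fun n => ∫ ω, average r n ω ∂G.law π s) atTop (nhds v) := by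
  obtain ⟨H, hH⟩ := exists_abs_le h
  obtain ⟨R, hR⟩ := exists_abs_le r
  obtain ⟨b, hb, hlim⟩ := exists_tendsto_integral_liminf (G.law π s)
    (fun n => (dependsUpTo_average r n).measurable) (abs_average_le hR)
  rw [expectation_meanPayoff] at hπ
  rw [EReal.coe_injective hπ] at hlim
  have h2 : Tendsto (fun n : ℕ => v + 2 * H / n) atTop (nhds v) := by
    simpa using (tendsto_const_div_atTop_nhds_zero_nat (2 * H)).const_add v
  refine tendsto_of_tendsto_of_tendsto_of_le_of_le' hlim h2 (Eventually.of_forall hb) ?_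
  filter_upwards [eventually_ge_atTop 1] with n hn
  exact integral_average_le heq hH π s hn

/-- A greedy strategy for a solution of the optimality equation attains the average reward `v`
almost surely. -/
theorem ae_tendsto_average_of_greedy {G : MDP S} {r h : S → ℝ} {v : ℝ}
    (heq : ∀ s, h s + v = r s + G.opt h s) {π : G.Strategy}
    (hπ : ∀ v s, G.nextExp π v s h = G.opt h s) (s : S) :
    ∀ᵐ ω ∂G.law π s, Tendsto (fun n => average r n ω) atTop (nhds v) := by
  filter_upwards [G.ae_tendsto_average π r h v s] with ω hω
  apply hω
  have : ∀ i, r (ω i) + G.nextExp π (hist ω i) (ω i) h - h (ω i) - v = 0 := fun i => by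
    rw [hπ]; linarith [heq (ω i)]
  simp [this]

theorem value_meanPayoff {G : MDP S} {r h : S → ℝ} {v : ℝ}
    (heq : ∀ s, h s + v = r s + G.opt h s) (s : S) : G.value (meanPayoff r) s = v := by
  refine le_antisymm (iSup_le fun π => expectation_meanPayoff_le heq π s) ?_
  obtain ⟨σ, hσ⟩ := G.exists_greedy h
  rw [← G.expectation_eq_of_ae_tendsto σ.toStrategy s (ae_of_all _ fun _ => rfl)
    (ae_tendsto_average_of_greedy heq hσ s)]
  exact le_iSup (fun π => G.expectation π s (meanPayoff r)) _

theorem exists_optimal_meanPayoff (G : MDP S) (hEC : G.IsEndComponent Set.univ) (r : S → ℝ) :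
    ∃ σ : G.PureMemoryless, ∀ s, G.IsOptimalFrom (meanPayoff r) σ.toStrategy s := by
  obtain ⟨v, h, heq⟩ := G.exists_optimality_equation hEC r
  obtain ⟨σ, hσ⟩ := G.exists_greedy h
  refine ⟨σ, fun s => ?_⟩
  rw [IsOptimalFrom, value_meanPayoff heq, G.expectation_eq_of_ae_tendsto σ.toStrategy s
    (ae_of_all _ fun _ => rfl) (ae_tendsto_average_of_greedy heq hσ s)]

/-- In a strongly connected Markov decision process, some pure memoryless strategy reaches a given
nonempty set almost surely from everywhere. -/
theorem exists_ae_reach (G : MDP S) (hEC : G.IsEndComponent Set.univ) {T : Set S}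
    (hT : T.Nonempty) :
    ∃ σ : G.PureMemoryless, ∀ s, ∀ᵐ ω ∂G.law σ.toStrategy s, ∃ n, ω n ∈ T := by
  obtain ⟨t, ht⟩ := hT
  -- Visits to `T` are rewarded: a play that avoids `T` has average 0, whereas greedy plays have the
  -- positive average `v` almost surely.
  obtain ⟨v, h, heq⟩ := G.exists_optimality_equation hEC (T.indicator 1)
  have hv : 0 < v := pos_of_optimality_equation hEC heq
    (fun s => Set.indicator_nonneg (fun _ _ => zero_le_one) s) (t := t) (by simp [ht])
  obtain ⟨σ, hσ⟩ := G.exists_greedy h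
  refine ⟨σ, fun s => ?_⟩
  filter_upwards [ae_tendsto_average_of_greedy heq hσ s] with ω hω
  by_contra! hno
  have h0 : ∀ n, average (T.indicator (1 : S → ℝ)) n ω = 0 := fun n => by simp [average, hno]
  simp only [h0] at hω
  exact hv.ne (tendsto_nhds_unique tendsto_const_nhds hω)

end MDP

/-! ### Chains induced by pure memoryless strategies: Poisson equation and hitting potential. -/

namespace MDP

variable {S : Type*} [Fintype S]

/-- The transition operator of the Markov chain that a pure memoryless strategy induces. -/
def chain (G : MDP S) (σ : G.PureMemoryless) : Module.End ℝ (S → ℝ) where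
  toFun f s := G.nextExp σ.toStrategy [] s f
  map_add' f g := by
    funext s
    simp [nextExp, mul_add, Finset.sum_add_distrib]
  map_smul' a f := by
    funext s
    exact nextExp_const_mul _ _ _ _ _ _

theorem nextExp_toStrategy (G : MDP S) (σ : G.PureMemoryless) (v : List S) (s : S) (f : S → ℝ) :
    G.nextExp σ.toStrategy v s f = G.chain σ f s := rfl

theorem chain_const (G : MDP S) (σ : G.PureMemoryless) (a : ℝ) :
    G.chain σ (fun _ => a) = fun _ => a :=
  funext fun _ => nextExp_const _ _ _ _ _

theorem chain_pow_const (G : MDP S) (σ : G.PureMemoryless) (a : ℝ) (n : ℕ) :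
    (G.chain σ ^ n) (fun _ => a) = fun _ => a := by
  induction n with
  | zero => rfl
  | succ n ih => rw [pow_succ, Module.End.mul_apply, chain_const, ih]

/-- On a finite dimensional space, a vector whose Cesàro means under `P` vanish is in the range
of `1 - P`. -/
theorem mem_range_one_sub_of_tendsto {P : Module.End ℝ (S → ℝ)} {f : S → ℝ}
    (h : Tendsto (fun n : ℕ => (n : ℝ)⁻¹ • ∑ i ∈ Finset.range n, (P ^ i) f) atTop (nhds 0)) :
    f ∈ LinearMap.range (1 - P) := by
  have hcl : IsClosed ((LinearMap.range (1 - P) : Submodule ℝ (S → ℝ)) : Set (S → ℝ)) :=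
    Submodule.closed_of_finiteDimensional _
  have hlim : Tendsto (fun n : ℕ => f - (n : ℝ)⁻¹ • ∑ i ∈ Finset.range n, (P ^ i) f) atTop
      (nhds f) := by simpa using h.const_sub f
  refine hcl.mem_of_tendsto hlim ?_
  filter_upwards [eventually_ge_atTop 1] with n hn
  have hn' : (n : ℝ) ≠ 0 := by positivity
  -- The geometric sum is a preimage. So `f` minus its Cesàro mean lies in the range, and `f` is the
  -- limit of these differences.
  have hi : ∀ i : ℕ, f - (P ^ i) f ∈ LinearMap.range (1 - P) := fun i =>
    ⟨(∑ j ∈ Finset.range i, P ^ j) f, by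
      rw [← Module.End.mul_apply, mul_neg_geom_sum]; rfl⟩
  have he : f - (n : ℝ)⁻¹ • ∑ i ∈ Finset.range n, (P ^ i) f =
      (n : ℝ)⁻¹ • ∑ i ∈ Finset.range n, (f - (P ^ i) f) := by
    rw [Finset.sum_sub_distrib, smul_sub]
    simp only [Finset.sum_const, Finset.card_range]
    rw [← Nat.cast_smul_eq_nsmul ℝ, inv_smul_smul₀ hn']
  rw [he]
  exact Submodule.smul_mem _ _ (Submodule.sum_mem _ fun i _ => hi i)

variable [MeasurableSpace S] [MeasurableSingletonClass S]

theorem integral_eval_law (G : MDP S) (σ : G.PureMemoryless) (s : S) (n : ℕ) (f : S → ℝ) :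
    ∫ ω, f (ω n) ∂G.law σ.toStrategy s = (G.chain σ ^ n) f s := by
  induction n generalizing f with
  | zero =>
    rw [integral_congr_ae (g := fun _ => f s)
      ((G.law_zero σ.toStrategy s).mono fun ω hω => by simp only [hω])]
    simp
  | succ n ih =>
    rw [G.integral_step σ.toStrategy s n (fun _ => f) (fun _ _ _ => rfl)]
    simp only [nextExp_toStrategy]
    rw [ih, pow_succ]
    rfl

/-- The Poisson equation holds for a pure memoryless strategy that is optimal from every state. -/
theorem exists_poisson {G : MDP S} {r h : S → ℝ} {v : ℝ}
    (heq : ∀ s, h s + v = r s + G.opt h s) {σ : G.PureMemoryless}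
    (hσ : ∀ s, G.expectation σ.toStrategy s (meanPayoff r) = v) :
    ∃ g : S → ℝ, ∀ s, g s + v = r s + G.chain σ g s := by
  -- At each state, the Cesàro mean of `r - v` is the expected average minus `v`. The function `h`
  -- itself need not solve the equation for `σ`, hence the new `g`.
  have hmem : (fun s => r s - v) ∈ LinearMap.range (1 - G.chain σ) := by
    refine mem_range_one_sub_of_tendsto (tendsto_pi_nhds.2 fun s => ?_)
    have h1 := (tendsto_integral_average heq (hσ s)).sub_const v
    rw [sub_self] at h1
    refine h1.congr' ?_
    filter_upwards [eventually_ge_atTop 1] with n hn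
    have hn' : (n : ℝ) ≠ 0 := by positivity
    have hpow : ∀ i, (G.chain σ ^ i) (fun s => r s - v) s = (G.chain σ ^ i) r s - v := by
      intro i
      have : (fun s => r s - v) = r - fun _ => v := rfl
      rw [this, map_sub, chain_pow_const]; rfl
    unfold average
    rw [integral_div, integral_finsetSum _ fun i _ =>
      DependsUpTo.integrable (n := i) (fun ω ω' h => by simp only [h i le_rfl]) _]
    simp only [integral_eval_law, Pi.smul_apply, Finset.sum_apply, hpow, Finset.sum_sub_distrib,
      Finset.sum_const, Finset.card_range, nsmul_eq_mul, smul_eq_mul]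
    field_simp
  obtain ⟨g, hg⟩ := hmem
  refine ⟨g, fun s => ?_⟩
  have := congrFun hg s
  simp only [LinearMap.sub_apply, Module.End.one_apply, Pi.sub_apply] at this
  linarith

open Classical in
/-- The transition operator of the chain that is killed in `T`. -/
def killed (G : MDP S) (σ : G.PureMemoryless) (T : Set S) : Module.End ℝ (S → ℝ) where
  toFun f s := if s ∈ T then 0 else G.chain σ f s
  map_add' f g := by
    funext s
    by_cases hs : s ∈ T <;> simp [hs]
  map_smul' a f := by
    funext s
    by_cases hs : s ∈ T <;> simp [hs]

open Classical in
theorem integral_killed (G : MDP S) (σ : G.PureMemoryless) (T : Set S) (s : S) (n : ℕ)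
    (f : S → ℝ) :
    ∫ ω, (if ∀ i < n, ω i ∉ T then f (ω n) else 0) ∂G.law σ.toStrategy s =
      (G.killed σ T ^ n) f s := by
  induction n generalizing f with
  | zero =>
    rw [integral_congr_ae (g := fun _ => f s)
      ((G.law_zero σ.toStrategy s).mono fun ω hω => by simp [hω])]
    simp
  | succ n ih =>
    rw [G.integral_step σ.toStrategy s n
      (fun ω t => if ∀ i < n + 1, ω i ∉ T then f t else 0) ?_]
    · rw [pow_succ, Module.End.mul_apply, ← ih]
      refine integral_congr_ae (ae_of_all _ fun ω => ?_)
      simp only [Nat.forall_lt_succ_right]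
      by_cases h1 : ∀ i < n, ω i ∉ T
      · by_cases h2 : ω n ∈ T
        · simp [h2, killed, nextExp]
        · have h3 : G.killed σ T f (ω n) = G.chain σ f (ω n) := by simp [killed, h2]
          simp only [h2, not_false_eq_true, and_true, if_pos h1, nextExp_toStrategy, h3]
      · simp [h1, nextExp]
    · intro ω ω' h
      have : (∀ i < n + 1, ω i ∉ T) ↔ ∀ i < n + 1, ω' i ∉ T :=
        forall₂_congr fun i hi => by rw [h i (by omega)]
      simp only [this]

/-- An upper bound for the expected time to reach `T`. -/
theorem exists_reach_potential {G : MDP S} {σ : G.PureMemoryless} {T : Set S}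
    (hσ : ∀ s, ∀ᵐ ω ∂G.law σ.toStrategy s, ∃ n, ω n ∈ T) :
    ∃ K : S → ℝ, (∀ s, 0 ≤ K s) ∧ ∀ s, s ∉ T → G.chain σ K s + 1 ≤ K s := by
  classical
  set U := G.killed σ T
  have hlim : ∀ s, Tendsto (fun n => (U ^ n) (fun _ => 1) s) atTop (nhds 0) := by
    intro s
    have h := tendsto_integral_of_dominated_convergence (μ := G.law σ.toStrategy s)
      (F := fun n ω => if ∀ i < n, ω i ∉ T then (1 : ℝ) else 0) (f := fun _ => 0) (fun _ => 1)
      (fun n => (DependsUpTo.measurable (n := n) fun ω ω' h => by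
        have : (∀ i < n, ω i ∉ T) ↔ ∀ i < n, ω' i ∉ T :=
          forall₂_congr fun i hi => by rw [h i hi.le]
        simp only [this]).aestronglyMeasurable)
      (integrable_const _) (fun n => ae_of_all _ fun ω => by split_ifs <;> simp) (by
        filter_upwards [hσ s] with ω ⟨m, hm⟩
        refine tendsto_const_nhds.congr' ?_
        filter_upwards [eventually_gt_atTop m] with n hn
        rw [if_neg fun h => h m hn hm])
    simp only [integral_zero] at h
    exact h.congr fun n => G.integral_killed σ T s n fun _ => 1
  have hnn : ∀ n s, 0 ≤ (U ^ n) (fun _ => 1) s := fun n s => by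
    rw [← integral_killed]
    exact integral_nonneg fun ω => by dsimp only; split_ifs <;> simp
  -- `(U ^ n) 1` is the probability of avoiding `T` before time `n`. It tends to 0 at each of the
  -- finitely many states, so one `n` serves them all.
  obtain ⟨n, hn⟩ : ∃ n, ∀ s, (U ^ n) (fun _ => 1) s ≤ 1 / 2 :=
    (eventually_all.2 fun s => (hlim s).eventually_le_const (by norm_num)).exists
  -- Off `T` the sum telescopes to `K - chain K = 2 * (1 - (U ^ n) 1) ≥ 1`; the factor 2 allows the
  -- sum to be truncated, so no infinite series of hitting times is needed.
  refine ⟨fun s => 2 * ∑ j ∈ Finset.range n, (U ^ j) (fun _ => 1) s,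
    fun s => mul_nonneg zero_le_two (Finset.sum_nonneg fun j _ => hnn j s), fun s hs => ?_⟩
  have hK : (fun s => 2 * ∑ j ∈ Finset.range n, (U ^ j) (fun _ => 1) s) =
      (2 : ℝ) • ∑ j ∈ Finset.range n, (U ^ j) (fun _ => 1) := by
    funext s; simp
  have hU : G.chain σ (fun s => 2 * ∑ j ∈ Finset.range n, (U ^ j) (fun _ => 1) s) s =
      2 * ∑ j ∈ Finset.range n, (U ^ (j + 1)) (fun _ => 1) s := by
    have h1 : ∀ f, G.chain σ f s = U f s := fun f => by simp [U, killed, hs]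
    rw [h1, hK, map_smul, map_sum]
    simp [pow_succ']
  have h2 := Finset.sum_range_succ' (fun j => (U ^ j) (fun _ => (1 : ℝ)) s) n
  rw [Finset.sum_range_succ] at h2
  have h3 := hn s
  simp only [pow_zero, Module.End.one_apply] at h2
  rw [hU]
  linarith

end MDP

/-! ### Analysis of the counter-based strategy. -/

namespace MDP

open CounterMemory

variable {S : Type*}

/-- The stage of the counter-based strategy that determines the move at time `n`. -/
def stage (p : S → ℕ) (ℓ : ℕ → ℕ → ℕ) (ω : ℕ → S) (n : ℕ) : CounterMemory :=
  currentStage p ℓ (memoryAfter p ℓ (hist ω n)) (ω n)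

theorem stage_zero (p : S → ℕ) (ℓ : ℕ → ℕ → ℕ) (ω : ℕ → S) :
    stage p ℓ ω 0 = enterRound p ℓ 1 0 (ω 0) := rfl

theorem stage_succ (p : S → ℕ) (ℓ : ℕ → ℕ → ℕ) (ω : ℕ → S) (n : ℕ) :
    stage p ℓ ω (n + 1) = currentStage p ℓ (countStep (stage p ℓ ω n)) (ω (n + 1)) := by
  rw [stage, hist_succ, memoryAfter, List.foldl_append]
  rfl

theorem dependsUpTo_stage (p : S → ℕ) (ℓ : ℕ → ℕ → ℕ) (n : ℕ) :
    DependsUpTo n fun ω => stage p ℓ ω n := by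
  intro ω ω' h
  simp only [stage, hist_congr fun i hi => h i hi.le, h n le_rfl]

/-- An expired counter is turned into a new round before the move is chosen, so a stage 2 that
determines a move has a step left. -/
theorem pos_of_stage_eq_optimize {p : S → ℕ} {ℓ : ℕ → ℕ → ℕ} (hℓ : ∀ i k, 0 < ℓ i k) {ω : ℕ → S}
    {n i m : ℕ} (h : stage p ℓ ω n = optimize i m) : 0 < m := by
  unfold stage at h
  cases hq : memoryAfter p ℓ (hist ω n) with
  | reach j k =>
    simp only [hq, currentStage, enterRound] at h
    split_ifs at h
    cases h
    exact hℓ _ _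
  | optimize j k =>
    cases k with
    | zero =>
      simp only [hq, currentStage, enterRound] at h
      split_ifs at h
      cases h
      exact hℓ _ _
    | succ k =>
      simp only [hq, currentStage] at h
      cases h
      exact k.succ_pos

theorem ne_of_stage_eq_reach {p : S → ℕ} {ℓ : ℕ → ℕ → ℕ} {ω : ℕ → S}
    {n i k : ℕ} (h : stage p ℓ ω n = reach i k) : p (ω n) ≠ minPriority p := by
  unfold stage at h
  cases hq : memoryAfter p ℓ (hist ω n) with
  | reach j k =>
    simp only [hq, currentStage, enterRound] at h
    split_ifs at h with h1
    exact h1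
  | optimize j k =>
    cases k with
    | zero =>
      simp only [hq, currentStage, enterRound] at h
      split_ifs at h with h1
      exact h1
    | succ k => simp [hq, currentStage] at h

/-- The number of the round. -/
def round : CounterMemory → ℕ
  | reach i _ => i
  | optimize i _ => i

/-- The indicator of stage 1. -/
def reachInd : CounterMemory → ℝ
  | reach _ _ => 1
  | optimize _ _ => 0

theorem reachInd_nonneg (q : CounterMemory) : 0 ≤ reachInd q := by
  cases q <;> simp [reachInd]

theorem abs_reachInd_le (q : CounterMemory) : |reachInd q| ≤ 1 := by
  cases q <;> simp [reachInd]

/-- A lower bound for the number of steps that have been played since round `i₀` began, if all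
stages of optimization take at least `N` steps from then on. -/
def stepsSince (N i₀ : ℕ) : CounterMemory → ℕ
  | reach i _ => N * (i - i₀)
  -- The subtraction `N - m` is truncated: nothing is counted while at least `N` steps remain.
  | optimize i m => if i₀ ≤ i then N * (i - i₀) + (N - m) else 0

theorem stepsSince_enterRound {p : S → ℕ} {ℓ : ℕ → ℕ → ℕ} {N i₀ : ℕ}
    (hN : ∀ i ≥ i₀, ∀ k, N ≤ ℓ i k) (i k : ℕ) (s : S) :
    stepsSince N i₀ (enterRound p ℓ i k s) ≤ N * (i - i₀) := by
  unfold enterRound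
  split_ifs
  · simp only [stepsSince]
    split_ifs with h
    · have := hN i h k
      omega
    · exact Nat.zero_le _
  · exact le_rfl

/-- Each step of stage 2 raises the count by at most one, and starting a round never raises it
beyond `N` per completed round. Steps of stage 1 add nothing. -/
theorem stepsSince_stage_le {p : S → ℕ} {ℓ : ℕ → ℕ → ℕ} {N i₀ : ℕ} (hℓ : ∀ i k, 0 < ℓ i k)
    (h1 : 1 ≤ i₀) (hN : ∀ i ≥ i₀, ∀ k, N ≤ ℓ i k) (ω : ℕ → S) (n : ℕ) :
    stepsSince N i₀ (stage p ℓ ω n) ≤ n := by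
  induction n with
  | zero =>
    refine (stepsSince_enterRound hN 1 0 (ω 0)).trans ?_
    simp [Nat.sub_eq_zero_of_le h1]
  | succ n ih =>
    rw [stage_succ]
    cases hq : stage p ℓ ω n with
    | reach i k =>
      rw [hq] at ih
      exact (stepsSince_enterRound hN i (k + 1) _).trans (ih.trans n.le_succ)
    | optimize i m =>
      have hm := pos_of_stage_eq_optimize hℓ hq
      rw [hq] at ih
      obtain ⟨m, rfl⟩ := Nat.exists_eq_succ_of_ne_zero hm.ne'
      cases m with
      | zero =>
        refine (stepsSince_enterRound hN (i + 1) 0 _).trans ?_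
        simp only [stepsSince] at ih
        split_ifs at ih with hi
        · have e : i + 1 - i₀ = (i - i₀) + 1 := by omega
          rw [e, mul_add, mul_one]
          omega
        · have e : i + 1 - i₀ = 0 := by omega
          simp [e]
      | succ m =>
        simp only [countStep, currentStage, stepsSince, Nat.succ_eq_add_one,
          Nat.add_sub_cancel] at ih ⊢
        split_ifs at ih ⊢ <;> omega

theorem le_stepsSince (N i₀ : ℕ) (q : CounterMemory) : N * (round q - i₀) ≤ stepsSince N i₀ q := by
  cases q with
  | reach i k => exact le_rfl
  | optimize i m =>
    simp only [round, stepsSince]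
    split_ifs with h
    · exact Nat.le_add_right _ _
    · simp [Nat.sub_eq_zero_of_le (not_le.1 h).le]

/-- The rounds become longer and longer, so that their number grows sublinearly. -/
theorem tendsto_round_div {p : S → ℕ} {ℓ : ℕ → ℕ → ℕ} (hℓ : GrowingLengths ℓ) (ω : ℕ → S) :
    Tendsto (fun n : ℕ => (round (stage p ℓ ω n) : ℝ) / n) atTop (nhds 0) := by
  refine Metric.tendsto_atTop'.2 fun ε hε => ?_
  -- From `N * round ≤ N * i₀ + n`, this `N` makes the part `n / N` less than half of `ε * n`; the
  -- choice of `n₀` below makes `i₀` less than the other half.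
  obtain ⟨N, hN⟩ := exists_nat_gt (2 / ε)
  have hN0 : (0 : ℝ) < N := (div_pos two_pos hε).trans hN
  obtain ⟨i₁, hi₁⟩ := eventually_atTop.1 (hℓ.2 N)
  set i₀ := max i₁ 1
  have key : ∀ n, N * round (stage p ℓ ω n) ≤ N * i₀ + n := by
    intro n
    have h1 := (le_stepsSince N i₀ _).trans (stepsSince_stage_le (p := p) hℓ.1 (le_max_right i₁ 1)
      (fun i hi => hi₁ i ((le_max_left _ _).trans hi)) ω n)
    have h2 : N * round (stage p ℓ ω n) ≤ N * (i₀ + (round (stage p ℓ ω n) - i₀)) :=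
      Nat.mul_le_mul_left _ (by omega)
    rw [mul_add] at h2
    omega
  obtain ⟨n₀, hn₀⟩ := exists_nat_gt (2 * i₀ / ε)
  refine ⟨n₀, fun n hn => ?_⟩
  have hnn : (n₀ : ℝ) < n := by exact_mod_cast hn
  have hnpos : (0 : ℝ) < n := (Nat.cast_nonneg _).trans_lt hnn
  rw [Real.dist_eq, sub_zero, abs_of_nonneg (by positivity), div_lt_iff₀ hnpos]
  have h1 : (N : ℝ) * round (stage p ℓ ω n) ≤ N * i₀ + n := by exact_mod_cast key n
  have h2 : 2 * (i₀ : ℝ) < ε * n := by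
    have := hn₀.trans hnn
    rw [div_lt_iff₀ hε] at this
    linarith
  have h3 : 2 < ε * N := by
    rw [div_lt_iff₀ hε] at hN
    linarith
  have h4 : (N : ℝ) * (2 * i₀) < N * (ε * n) := mul_lt_mul_of_pos_left h2 hN0
  have h5 : 2 * (n : ℝ) < ε * N * n := mul_lt_mul_of_pos_right h3 hnpos
  by_contra! h6
  have h7 := mul_le_mul_of_nonneg_left h6 hN0.le
  linarith

/-- A current stage 2 runs out after finitely many steps, and the following stage 1 can end only at
a state of minimum priority. -/
theorem exists_reach_of_forall_ne {p : S → ℕ} {ℓ : ℕ → ℕ → ℕ} (hℓ : ∀ i k, 0 < ℓ i k) {ω : ℕ → S}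
    {n₀ : ℕ} (h : ∀ n ≥ n₀, p (ω n) ≠ minPriority p) :
    ∃ n₁, ∀ n ≥ n₁, reachInd (stage p ℓ ω n) = 1 := by
  have hstay : ∀ n ≥ n₀, (∃ i k, stage p ℓ ω n = reach i k) →
      ∃ i k, stage p ℓ ω (n + 1) = reach i k := by
    rintro n hn ⟨i, k, hq⟩
    refine ⟨i, k + 1, ?_⟩
    rw [stage_succ, hq]
    simp [countStep, currentStage, enterRound, h (n + 1) (by omega)]
  have hleave : ∀ m i n, n₀ ≤ n → stage p ℓ ω n = optimize i (m + 1) →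
      ∃ n' ≥ n₀, ∃ i k, stage p ℓ ω n' = reach i k := by
    intro m
    induction m with
    | zero =>
      intro i n hn hq
      refine ⟨n + 1, by omega, i + 1, 0, ?_⟩
      rw [stage_succ, hq]
      simp [countStep, currentStage, enterRound, h (n + 1) (by omega)]
    | succ m ih =>
      intro i n hn hq
      refine ih i (n + 1) (by omega) ?_
      rw [stage_succ, hq]
      rfl
  obtain ⟨n₁, hn₁, hr⟩ : ∃ n' ≥ n₀, ∃ i k, stage p ℓ ω n' = reach i k := by
    cases hq : stage p ℓ ω n₀ with
    | reach i k => exact ⟨n₀, le_rfl, i, k, hq⟩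
    | optimize i m =>
      obtain ⟨m, rfl⟩ := Nat.exists_eq_succ_of_ne_zero (pos_of_stage_eq_optimize hℓ hq).ne'
      exact hleave m i n₀ le_rfl hq
  refine ⟨n₁, fun n hn => ?_⟩
  have : ∃ i k, stage p ℓ ω n = reach i k := by
    induction n, hn using Nat.le_induction with
    | base => exact hr
    | succ n hn ih => exact hstay n (hn₁.trans hn) ih
  obtain ⟨i, k, hq⟩ := this
  rw [hq, reachInd]

/-- If the fraction of time that is spent in stage 1 vanishes, then a state of minimum priority is
visited infinitely often. -/
theorem frequently_minPriority {p : S → ℕ} {ℓ : ℕ → ℕ → ℕ} (hℓ : ∀ i k, 0 < ℓ i k) {ω : ℕ → S}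
    (h : Tendsto (fun n : ℕ => (∑ i ∈ Finset.range n, reachInd (stage p ℓ ω i)) / n) atTop
      (nhds 0)) : ∃ᶠ n in atTop, p (ω n) = minPriority p := by
  intro hno
  obtain ⟨n₀, hn₀⟩ := eventually_atTop.1 hno
  obtain ⟨n₁, hn₁⟩ := exists_reach_of_forall_ne (ℓ := ℓ) hℓ hn₀
  have hle : ∀ n : ℕ, (n : ℝ) - n₁ ≤ ∑ i ∈ Finset.range n, reachInd (stage p ℓ ω i) := by
    intro n
    induction n with
    | zero => simp
    | succ n ih =>
      rw [Finset.sum_range_succ]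
      push_cast
      rcases le_or_gt n₁ n with hn | hn
      · rw [hn₁ n hn]; linarith
      · have h1 : ((n : ℝ) + 1) ≤ n₁ := by exact_mod_cast hn
        have h2 := Finset.sum_nonneg fun i (_ : i ∈ Finset.range n) =>
          reachInd_nonneg (stage p ℓ ω i)
        linarith [reachInd_nonneg (stage p ℓ ω n)]
  have hlim : Tendsto (fun n : ℕ => 1 - (n₁ : ℝ) / n) atTop (nhds 1) := by
    simpa using (tendsto_const_div_atTop_nhds_zero_nat (n₁ : ℝ)).const_sub 1
  have : (1 : ℝ) ≤ 0 := by
    refine le_of_tendsto_of_tendsto hlim h ?_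
    filter_upwards [eventually_ge_atTop 1] with n hn
    have hn' : (0 : ℝ) < n := by exact_mod_cast hn
    rw [le_div_iff₀ hn', sub_mul, div_mul_cancel₀ _ hn'.ne', one_mul]
    exact hle n
  linarith

/-- By finiteness a single state of minimum priority recurs, and no priority is smaller. -/
theorem parity_of_frequently [Finite S] {p : S → ℕ} (hp : Even (minPriority p)) {ω : ℕ → S}
    (h : ∃ᶠ n in atTop, p (ω n) = minPriority p) : Parity p ω := by
  obtain ⟨s, hs, hps⟩ : ∃ s ∈ infSet ω, p s = minPriority p := by
    by_contra! hno
    refine h ?_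
    have : ∀ᶠ n in atTop, ∀ s, p s = minPriority p → ω n ≠ s := by
      refine eventually_all.2 fun s => ?_
      by_cases hs : p s = minPriority p
      · exact (not_frequently.1 fun hf => hno s hf hs).mono fun n hn _ => hn
      · exact Eventually.of_forall fun n h => (hs h).elim
    exact this.mono fun n hn hpn => hn _ hpn rfl
  have hmin : sInf (p '' infSet ω) = minPriority p := by
    refine le_antisymm (hps ▸ Nat.sInf_le ⟨s, hs, rfl⟩) ?_
    obtain ⟨t, -, ht⟩ := Nat.sInf_mem (s := p '' infSet ω) ⟨p s, s, hs, rfl⟩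
    rw [← ht]
    exact Nat.sInf_le ⟨t, rfl⟩
  rw [Parity, hmin]
  exact hp

section Expectation

variable [Fintype S]

theorem nextExp_counterStrategy_reach {G : MDP S} {p : S → ℕ} (σS σm : G.PureMemoryless)
    {ℓ : ℕ → ℕ → ℕ} {ω : ℕ → S} {n i k : ℕ} (h : stage p ℓ ω n = reach i k) (f : S → ℝ) :
    G.nextExp (counterStrategy p σS σm ℓ) (hist ω n) (ω n) f = G.chain σS f (ω n) := by
  rw [← nextExp_toStrategy G σS (hist ω n)]
  have : G.nextState (counterStrategy p σS σm ℓ) (hist ω n) (ω n) =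
      G.nextState σS.toStrategy (hist ω n) (ω n) := by
    unfold nextState
    split_ifs with hs
    · unfold stage at h
      simp only [counterStrategy, h]
    · rfl
  rw [nextExp, nextExp, this]

theorem nextExp_counterStrategy_optimize {G : MDP S} {p : S → ℕ} (σS σm : G.PureMemoryless)
    {ℓ : ℕ → ℕ → ℕ} {ω : ℕ → S} {n i m : ℕ} (h : stage p ℓ ω n = optimize i m) (f : S → ℝ) :
    G.nextExp (counterStrategy p σS σm ℓ) (hist ω n) (ω n) f = G.chain σm f (ω n) := by
  rw [← nextExp_toStrategy G σm (hist ω n)]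
  have : G.nextState (counterStrategy p σS σm ℓ) (hist ω n) (ω n) =
      G.nextState σm.toStrategy (hist ω n) (ω n) := by
    unfold nextState
    split_ifs with hs
    · unfold stage at h
      simp only [counterStrategy, h]
    · rfl
  rw [nextExp, nextExp, this]

/-- An amortized count with potential `K`: each new round supplies at most `C`, each step of stage 1
pays 1 out of the expected drop of `K`, and leaving stage 1 discards a nonnegative remainder. The
transform, switched on only in stage 1, records the deviation of `K` from its expectation. -/
theorem sum_reachInd_le {G : MDP S} {p : S → ℕ} {σS σm : G.PureMemoryless} {ℓ : ℕ → ℕ → ℕ}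
    (hℓ : ∀ i k, 0 < ℓ i k)
    {K : S → ℝ} {C : ℝ} (hK0 : ∀ s, 0 ≤ K s) (hKC : ∀ s, K s ≤ C)
    (hK : ∀ s, p s ≠ minPriority p → G.chain σS K s + 1 ≤ K s) (ω : ℕ → S) (n : ℕ) :
    ∑ i ∈ Finset.range n, reachInd (stage p ℓ ω i) + reachInd (stage p ℓ ω n) * K (ω n) ≤
      C * round (stage p ℓ ω n) +
        G.mgSum (counterStrategy p σS σm ℓ) (fun n ω => reachInd (stage p ℓ ω n)) K n ω := by
  have hC : 0 ≤ C := (hK0 (ω 0)).trans (hKC _)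
  induction n with
  | zero =>
    simp only [Finset.range_zero, Finset.sum_empty, mgSum, zero_add, add_zero, stage_zero]
    unfold enterRound
    split_ifs
    · simpa [reachInd, round] using hC
    · simpa [reachInd, round] using hKC _
  | succ n ih =>
    rw [Finset.sum_range_succ, mgSum, Finset.sum_range_succ, ← mgSum, mgInc, stage_succ]
    cases hq : stage p ℓ ω n with
    | reach i k =>
      have h1 := hK _ (ne_of_stage_eq_reach hq)
      rw [nextExp_counterStrategy_reach σS σm hq]
      rw [hq] at ih
      simp only [reachInd, round, countStep, currentStage, enterRound, one_mul] at ih ⊢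
      have h2 := hK0 (ω (n + 1))
      split_ifs
      · simp only [zero_mul]; linarith
      · simp only [one_mul]; linarith
    | optimize i m =>
      obtain ⟨m, rfl⟩ := Nat.exists_eq_succ_of_ne_zero (pos_of_stage_eq_optimize hℓ hq).ne'
      rw [hq] at ih
      have h2 := hKC (ω (n + 1))
      cases m with
      | zero =>
        simp only [reachInd, round, countStep, currentStage, enterRound, Nat.succ_eq_add_one,
          zero_add, Nat.sub_self] at ih ⊢
        split_ifs <;> push_cast <;> simp only [zero_mul, one_mul] at * <;> linarith
      | succ m =>
        simp only [reachInd, round, countStep, currentStage, Nat.succ_eq_add_one,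
          Nat.add_sub_cancel, zero_mul, add_zero] at ih ⊢
        exact ih

end Expectation

variable [Fintype S] [MeasurableSpace S] [MeasurableSingletonClass S]

theorem ae_tendsto_sum_reachInd {G : MDP S} {p : S → ℕ} {σS : G.PureMemoryless}
    (σm : G.PureMemoryless) {ℓ : ℕ → ℕ → ℕ} (hℓ : GrowingLengths ℓ)
    (hS : ∀ s, ∀ᵐ ω ∂(G.law σS.toStrategy s), ∃ n, p (ω n) = minPriority p) (s : S) :
    ∀ᵐ ω ∂G.law (counterStrategy p σS σm ℓ) s,
      Tendsto (fun n : ℕ => (∑ i ∈ Finset.range n, reachInd (stage p ℓ ω i)) / n) atTop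
        (nhds 0) := by
  obtain ⟨K, hK0, hK⟩ := exists_reach_potential (T := {s | p s = minPriority p}) hS
  obtain ⟨C, hC⟩ := exists_abs_le K
  filter_upwards [G.ae_tendsto_mgSum_div (counterStrategy p σS σm ℓ)
    (c := fun n ω => reachInd (stage p ℓ ω n)) K
    (fun n ω ω' h => congrArg reachInd (dependsUpTo_stage p ℓ n ω ω' h))
    (fun n ω => abs_reachInd_le _) s] with ω hω
  have hlim := ((tendsto_round_div (p := p) hℓ ω).const_mul C).add hω
  rw [mul_zero, add_zero] at hlim
  refine squeeze_zero (fun n => div_nonneg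
    (Finset.sum_nonneg fun i _ => reachInd_nonneg _) (Nat.cast_nonneg _)) (fun n => ?_) hlim
  rw [← mul_div_assoc, ← add_div]
  gcongr
  have h1 := sum_reachInd_le (σm := σm) hℓ.1 hK0 (fun s => (abs_le.1 (hC s)).2) hK ω n
  have h2 := mul_nonneg (reachInd_nonneg (stage p ℓ ω n)) (hK0 (ω n))
  linarith

/-- The error in the Poisson equation for `g` is zero in stage 2 and bounded by a constant in stage
1, so it vanishes on average. -/
theorem ae_tendsto_average_counterStrategy {G : MDP S} {p : S → ℕ} {σS σm : G.PureMemoryless}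
    {ℓ : ℕ → ℕ → ℕ} {r g : S → ℝ} {v : ℝ} (hg : ∀ s, g s + v = r s + G.chain σm g s) {s : S}
    (hreach : ∀ᵐ ω ∂G.law (counterStrategy p σS σm ℓ) s,
      Tendsto (fun n : ℕ => (∑ i ∈ Finset.range n, reachInd (stage p ℓ ω i)) / n) atTop
        (nhds 0)) :
    ∀ᵐ ω ∂G.law (counterStrategy p σS σm ℓ) s,
      Tendsto (fun n => average r n ω) atTop (nhds v) := by
  obtain ⟨D, hD⟩ := exists_abs_le fun s => r s + G.chain σS g s - g s - v
  filter_upwards [G.ae_tendsto_average (counterStrategy p σS σm ℓ) r g v s, hreach] with ω h1 h2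
  refine h1 ?_
  have h3 := h2.const_mul D
  rw [mul_zero] at h3
  refine squeeze_zero_norm (fun n => ?_) h3
  rw [Real.norm_eq_abs, abs_div, Nat.abs_cast, ← mul_div_assoc, Finset.mul_sum]
  gcongr
  refine (Finset.abs_sum_le_sum_abs _ _).trans (Finset.sum_le_sum fun i _ => ?_)
  cases hq : stage p ℓ ω i with
  | reach j k =>
    rw [nextExp_counterStrategy_reach σS σm hq, reachInd, mul_one]
    exact hD _
  | optimize j k =>
    rw [nextExp_counterStrategy_optimize σS σm hq, reachInd, mul_zero]
    refine le_of_eq (abs_eq_zero.2 ?_)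
    linarith [hg (ω i)]

/-- The counter-based strategy attains the optimal average reward for the mean-payoff parity
objective. -/
theorem expectation_counterStrategy {G : MDP S} {p : S → ℕ} {r h : S → ℝ} {v : ℝ}
    (heq : ∀ s, h s + v = r s + G.opt h s) (hp : Even (minPriority p)) {σS σm : G.PureMemoryless}
    (hS : ∀ s, ∀ᵐ ω ∂(G.law σS.toStrategy s), ∃ n, p (ω n) = minPriority p)
    (hm : ∀ s, G.IsOptimalFrom (meanPayoff r) σm.toStrategy s) {ℓ : ℕ → ℕ → ℕ}
    (hℓ : GrowingLengths ℓ) (s : S) :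
    G.expectation (counterStrategy p σS σm ℓ) s (meanPayoffParity p r) = v := by
  obtain ⟨g, hg⟩ := exists_poisson heq fun s => (hm s).symm.trans (value_meanPayoff heq s)
  have hreach := ae_tendsto_sum_reachInd σm hℓ hS s
  refine G.expectation_eq_of_ae_tendsto _ s ?_ (ae_tendsto_average_counterStrategy hg hreach)
  filter_upwards [hreach] with ω hω
  rw [meanPayoffParity, if_pos (parity_of_frequently hp (frequently_minPriority hℓ.1 hω))]

/-- Either parity holds almost surely and both integrands agree, or the left side is `⊥`. -/
theorem expectation_meanPayoffParity_le (G : MDP S) (π : G.Strategy) (p : S → ℕ) (r : S → ℝ)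
    (s : S) : G.expectation π s (meanPayoffParity p r) ≤ G.expectation π s (meanPayoff r) := by
  by_cases h : ∀ᵐ ω ∂G.law π s, meanPayoffParity p r ω ≠ ⊥
  · refine le_of_eq ?_
    rw [expectation_meanPayoff, expectation, if_pos h]
    congr 1
    refine integral_congr_ae (h.mono fun ω hω => ?_)
    unfold meanPayoffParity at hω ⊢
    by_cases h1 : Parity p ω
    · simp only [if_pos h1]
      rfl
    · exact (hω (if_neg h1)).elim
  · rw [expectation, if_neg h]
    exact bot_le

theorem exists_reach_minPriority (G : MDP S) (hEC : G.IsEndComponent Set.univ) (p : S → ℕ) :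
    ∃ σS : G.PureMemoryless, ∀ s : S,
      ∀ᵐ ω ∂(G.law σS.toStrategy s), ∃ n : ℕ, p (ω n) = minPriority p :=
  G.exists_ae_reach hEC (T := {s | p s = minPriority p})
    (Nat.sInf_mem (s := Set.range p) ⟨p G.init, G.init, rfl⟩)

theorem value_meanPayoffParity {G : MDP S} (hEC : G.IsEndComponent Set.univ) {p : S → ℕ}
    {r h : S → ℝ} {v : ℝ} (heq : ∀ s, h s + v = r s + G.opt h s) (hp : Even (minPriority p))
    (s : S) : G.value (meanPayoffParity p r) s = v := by
  refine le_antisymm (iSup_le fun π => (G.expectation_meanPayoffParity_le π p r s).trans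
    (expectation_meanPayoff_le heq π s)) ?_
  obtain ⟨σS, hS⟩ := G.exists_reach_minPriority hEC p
  obtain ⟨σm, hm⟩ := G.exists_optimal_meanPayoff hEC r
  -- Any growing lengths would do; the resulting counter-based strategy witnesses the lower bound.
  have hℓ : GrowingLengths fun i _ => i + 1 :=
    ⟨fun i _ => i.succ_pos, fun N => (eventually_ge_atTop N).mono fun i hi _ => Nat.le_succ_of_le hi⟩
  rw [← expectation_counterStrategy heq hp hS hm hℓ s]
  exact le_iSup (fun π => G.expectation π s (meanPayoffParity p r)) _

end MDP

end

theorem mainTheorem3 {S : Type*} [Fintype S] [MeasurableSpace S] [MeasurableSingletonClass S]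
    (G : MDP S) (p : S → ℕ) (r : S → ℝ)
    (hEC : G.IsEndComponent Set.univ) (hp : Even (MDP.minPriority p)) :
    (∀ s : S, G.value (MDP.meanPayoffParity p r) s = G.value (MDP.meanPayoff r) s) ∧
    (∃ σS : G.PureMemoryless, ∀ s : S,
      ∀ᵐ ω ∂(G.law σS.toStrategy s), ∃ n : ℕ, p (ω n) = MDP.minPriority p) ∧
    (∃ σm : G.PureMemoryless, ∀ s : S,
      G.IsOptimalFrom (MDP.meanPayoff r) σm.toStrategy s) ∧
    (∀ σS σm : G.PureMemoryless,
      (∀ s : S, ∀ᵐ ω ∂(G.law σS.toStrategy s), ∃ n : ℕ, p (ω n) = MDP.minPriority p) →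
      (∀ s : S, G.IsOptimalFrom (MDP.meanPayoff r) σm.toStrategy s) →
      ∀ ℓ : ℕ → ℕ → ℕ, MDP.GrowingLengths ℓ →
        ∀ s : S, G.IsOptimalFrom (MDP.meanPayoffParity p r)
          (MDP.counterStrategy p σS σm ℓ) s) := by
  obtain ⟨v, h, heq⟩ := G.exists_optimality_equation hEC r
  refine ⟨fun s => ?_, G.exists_reach_minPriority hEC p, G.exists_optimal_meanPayoff hEC r,
    fun σS σm hS hm ℓ hℓ s => ?_⟩
  · rw [MDP.value_meanPayoffParity hEC heq hp, MDP.value_meanPayoff heq]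
  · rw [MDP.IsOptimalFrom, MDP.value_meanPayoffParity hEC heq hp,
      MDP.expectation_counterStrategy heq hp hS hm hℓ]
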